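/- **Theorem 1 (convergence of MLorc-Lion).** Write $\|A\|_F$ for the Frobenius norm and $\|A\|_{1,1}=\sum_{i,j}|A_{ij}|$, and let $d=mn$. *Setting.* Let $f:\mathbb R^{m\times n}\to\mathbb R$ be differentiable and $L$-smooth: $\|\nabla f(W)-\nabla f(W')\|_F\le L\|W-W'\|_F$ for all $W,W'$. Let $\nabla f(W;\xi)$ be a stochastic gradient with $\mathbb E[\nabla f(W;\xi)]=\nabla f(W)$ and $\mathbb E\|\nabla f(W;\xi)-\nabla f(W)\|_F^2\le\sigma^2$ for all $W$ (with $\sigma\ge 0$). Let $r\ge2$, $p\ge2$, $r+p\le\min\{m,n\}$, $r\le k\le r+p$, $b\ge 1$, $T\ge 1$, and $\gamma=(1+\frac{r}{p-1})^{1/2}$. *Randomized SVD.* Given $A\in\mathbb R^{m\times n}$, $\mathrm{RSVD}(A,r,p)$ draws an $n\times(r+p)$ matrix $\Omega$ with i.i.d. standard Gaussian entries, forms $Y=A\Omega$, a QR decomposition $Y=QR$, and a singular value decomposition $Q^\top A=\tilde U\Sigma V^\top$, and returns the leading $k$ singular triples of $(Q\tilde U,\Sigma,V)$. (For $k=r+p$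 nothing is discarded; for $k=r$ the output has rank at most $r$.) *MLorc-Lion.* Start from a deterministic $W_1$ and $\tilde m_0=0$. For $t=1,2,\dots$ draw a fresh mini-batch of $b$ i.i.d. samples, independent of all the Gaussian matrices, let $g_t=\frac1b\sum_{i=1}^b\nabla f(W_t;\xi_t^i)$, and set $$c_t=\beta_1\tilde m_{t-1}+(1-\beta_1)g_t,\quad m_t=\beta_2\tilde m_{t-1}+(1-\beta_2)g_t,\quad W_{t+1}=W_t-\alpha\,\mathrm{sign}(c_t),$$ where $\tilde m_t=U_t\Sigma_tV_t^\top$ for $(U_t,\Sigma_t,V_t)=\mathrm{RSVD}(m_t,r,p)$ with a fresh $\Omega$. Assume $0\le\beta_1\le\frac1{4\gamma\sqrt d}$ and $0\le\beta_2<1$. *(a)* There is an absolute constant $C$ such that for every $\alpha>0$ $$\frac1T\sum_{t=1}^T\mathbb E\|\nabla f(W_t)\|_{1,1}\le C\Big[\frac{f(W_1)-\mathbb E f(W_{T+1})}{\alpha T}+\frac{\sigma\sqrt d}{\sqrt b\,T(1-\beta_2)}+\frac{2L\alpha\beta_1d}{1-\beta_2}+dL\alpha+\gamma\frac{\sigma\sqrt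 d}{\sqrt b}+(|\beta_1-\beta_2|+1-\beta_1)\frac{\sqrt d\,\sigma}{\sqrt{b(1-\beta_2)}}\Big],$$ all the expectations being finite. *(b)* Suppose moreover that $L>0$, that $f$ is bounded below, that $\gamma\le\Gamma$ and $\beta_2\le\bar\beta<1$, and let $\Delta=f(W_1)-\inf_Wf(W)$ and $\alpha=\sqrt{\Delta/(LdT)}$. There is a constant $C\ge 1$ depending only on $\Gamma$ and $\bar\beta$ such that $$\frac1T\sum_{t=1}^T\mathbb E\|\nabla f(W_t)\|_{1,1}\le C\Big[\frac{\sqrt{dL\Delta}}{\sqrt T}+\frac{\sigma\sqrt d}{\sqrt b}\Big].$$ *(c)* With the same $C$ and the setting of (b), let $\varepsilon>0$ with $\varepsilon^2\le\Delta Ld$. If $\sigma=0$, then $T=\lceil C\Delta Ld\,\varepsilon^{-2}\rceil\le 2C\Delta Ld\,\varepsilon^{-2}$ iterations make the average above at most $\varepsilon$. If $\varepsilon^2\le d\sigma^2$, then $T=\lceil C\Delta Ld\,\varepsilon^{-2}\rceil$ iterations with batch size $b=\lceil C d\sigma^2\varepsilon^{-2}\rceil$ make the average at most $\varepsilon$,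 using $bT\le 4C^2\,\Delta Ld^2\sigma^2\varepsilon^{-4}$ samples, i.e. $O(\Delta L d^2\sigma^2\varepsilon^{-4})$, the sample complexity of the original Lion. -/

import Mathlib

open MeasureTheory ProbabilityTheory
open scoped Matrix Matrix.Norms.Frobenius

noncomputable section

/-- Borel (entrywise) sigma-algebra on real matrices. -/
instance instMeasurableSpaceRealMatrix (m n : ℕ) :
    MeasurableSpace (Matrix (Fin m) (Fin n) ℝ) :=
  inferInstanceAs (MeasurableSpace (Fin m → Fin n → ℝ))

namespace MLorc

/- Throughout, the norm on matrices is the Frobenius norm. -/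

/-- The entrywise `ℓ₁` norm of a matrix. -/
def l1Norm {m n : ℕ} (A : Matrix (Fin m) (Fin n) ℝ) : ℝ := ∑ i, ∑ j, |A i j|

/-- The gradient of `f`, the matrix of its partial derivatives. -/
def grad {m n : ℕ} (f : Matrix (Fin m) (Fin n) ℝ → ℝ) (W : Matrix (Fin m) (Fin n) ℝ) :
    Matrix (Fin m) (Fin n) ℝ :=
  Matrix.of fun i j => fderiv ℝ f W (Matrix.single i j 1)

/-- `f` is `L`-smooth: differentiable, with `L`-Lipschitz gradient in the Frobenius norm. -/
structure LSmooth {m n : ℕ} (f : Matrix (Fin m) (Fin n) ℝ → ℝ) (L : ℝ) : Prop where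
  differentiable : Differentiable ℝ f
  lipschitz : ∀ W W', ‖grad f W - grad f W'‖ ≤ L * ‖W - W'‖

/-- `G W x` is an unbiased stochastic gradient of `f` at `W` for `x` of law `D`, with variance
at most `σ ^ 2`. -/
structure IsStochasticGradient {m n : ℕ} {Ξ : Type*} [MeasurableSpace Ξ]
    (f : Matrix (Fin m) (Fin n) ℝ → ℝ)
    (G : Matrix (Fin m) (Fin n) ℝ → Ξ → Matrix (Fin m) (Fin n) ℝ)
    (D : Measure Ξ) (σ : ℝ) : Prop where
  measurable : Measurable fun q : Matrix (Fin m) (Fin n) ℝ × Ξ => G q.1 q.2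
  integrable : ∀ W i j, Integrable (fun x => G W x i j) D
  unbiased : ∀ W i j, ∫ x, G W x i j ∂D = grad f W i j
  integrable_sq : ∀ W, Integrable (fun x => ‖G W x - grad f W‖ ^ 2) D
  variance_le : ∀ W, ∫ x, ‖G W x - grad f W‖ ^ 2 ∂D ≤ σ ^ 2

/-- A (measurable) routine computing a thin QR decomposition `Y = Q R` of every `m × l` matrix. -/
structure QRRoutine (m l : ℕ) where
  Q : Matrix (Fin m) (Fin l) ℝ → Matrix (Fin m) (Fin l) ℝ
  R : Matrix (Fin m) (Fin l) ℝ → Matrix (Fin l) (Fin l) ℝ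
  measurable_Q : Measurable Q
  measurable_R : Measurable R
  orthonormal : ∀ Y, (Q Y)ᵀ * Q Y = 1
  upper : ∀ Y i j, j < i → R Y i j = 0
  eq_mul : ∀ Y, Y = Q Y * R Y

/-- A (measurable) routine computing a thin singular value decomposition
`B = U diag(s) Vᵀ`, `s 0 ≥ s 1 ≥ ⋯ ≥ 0`, of every `l × n` matrix. -/
structure SVDRoutine (l n : ℕ) where
  U : Matrix (Fin l) (Fin n) ℝ → Matrix (Fin l) (Fin l) ℝ
  s : Matrix (Fin l) (Fin n) ℝ → Fin l → ℝ
  V : Matrix (Fin l) (Fin n) ℝ → Matrix (Fin n) (Fin l) ℝ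
  measurable_U : Measurable U
  measurable_s : Measurable s
  measurable_V : Measurable V
  orthonormal_U : ∀ B, (U B)ᵀ * U B = 1
  orthonormal_V : ∀ B, (V B)ᵀ * V B = 1
  nonneg : ∀ B i, 0 ≤ s B i
  antitone : ∀ B, Antitone (s B)
  eq_mul : ∀ B, B = U B * Matrix.diagonal (s B) * (V B)ᵀ

/-- Factors `(u, s, v)`, standing for the `m × n` matrix `u s vᵀ`. -/
structure Factors (m n k : ℕ) where
  u : Matrix (Fin m) (Fin k) ℝ
  s : Matrix (Fin k) (Fin k) ℝ
  v : Matrix (Fin n) (Fin k) ℝ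

/-- The matrix `u s vᵀ` represented by the factors. -/
def Factors.reconstruct {m n k : ℕ} (F : Factors m n k) : Matrix (Fin m) (Fin n) ℝ :=
  F.u * F.s * F.vᵀ

/-- Randomized SVD of `A` with test matrix `Om` (with `l` columns), from which the `k` leading
singular triples are returned: `Y = A Om`, `Y = Q R`, `B = Qᵀ A`, `B = Ũ Σ Vᵀ`, `U = Q Ũ`.
For `k = l` nothing is discarded. -/
def rsvd {m n l k : ℕ} (qr : QRRoutine m l) (svd : SVDRoutine l n) (hk : k ≤ l)
    (A : Matrix (Fin m) (Fin n) ℝ) (Om : Matrix (Fin n) (Fin l) ℝ) : Factors m n k :=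
  let Q := qr.Q (A * Om)
  let B := Qᵀ * A
  { u := (Q * svd.U B).submatrix id (Fin.castLE hk)
    s := Matrix.diagonal fun j => svd.s B (Fin.castLE hk j)
    v := (svd.V B).submatrix id (Fin.castLE hk) }

/-- The mini-batch gradient. -/
def batchGrad {m n b : ℕ} {Ξ : Type*}
    (G : Matrix (Fin m) (Fin n) ℝ → Ξ → Matrix (Fin m) (Fin n) ℝ)
    (W : Matrix (Fin m) (Fin n) ℝ) (x : Fin b → Ξ) : Matrix (Fin m) (Fin n) ℝ :=
  (1 / (b : ℝ)) • ∑ i, G W (x i)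

/-- State of MLorc-Lion: current weights and the stored momentum factors. -/
structure State (m n k : ℕ) where
  W : Matrix (Fin m) (Fin n) ℝ
  mom : Factors m n k

/-- One iteration of MLorc-Lion with mini-batch `x` and test matrix `Om`. -/
def step {m n l k b : ℕ} {Ξ : Type*} (qr : QRRoutine m l) (svd : SVDRoutine l n) (hk : k ≤ l)
    (G : Matrix (Fin m) (Fin n) ℝ → Ξ → Matrix (Fin m) (Fin n) ℝ) (β₁ β₂ α : ℝ)
    (x : Fin b → Ξ) (Om : Matrix (Fin n) (Fin l) ℝ) (S : State m n k) : State m n k :=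
  let g := batchGrad G S.W x
  let mtil := S.mom.reconstruct
  let c := β₁ • mtil + (1 - β₁) • g
  let mt := β₂ • mtil + (1 - β₂) • g
  { W := S.W - α • c.map Real.sign
    mom := rsvd qr svd hk mt Om }

/-- The state of MLorc-Lion after the given number of iterations, started from weights `W₁` and
zero momentum factors; iteration `t + 1` uses the mini-batch `x t` and the test matrix `Om t`. -/
def state {m n l k b : ℕ} {Ξ : Type*} (qr : QRRoutine m l) (svd : SVDRoutine l n) (hk : k ≤ l)
    (G : Matrix (Fin m) (Fin n) ℝ → Ξ → Matrix (Fin m) (Fin n) ℝ) (β₁ β₂ α : ℝ)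
    (W₁ : Matrix (Fin m) (Fin n) ℝ) (x : ℕ → Fin b → Ξ) (Om : ℕ → Matrix (Fin n) (Fin l) ℝ) :
    ℕ → State m n k
  | 0 => { W := W₁, mom := { u := 0, s := 0, v := 0 } }
  | t + 1 => step qr svd hk G β₁ β₂ α (x t) (Om t)
      (state qr svd hk G β₁ β₂ α W₁ x Om t)

/-- The weights `W_t`, `t = 1, 2, …`, of MLorc-Lion (`W_1` are the initial weights). -/
def weights {m n l k b : ℕ} {Ξ : Type*} (qr : QRRoutine m l) (svd : SVDRoutine l n) (hk : k ≤ l)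
    (G : Matrix (Fin m) (Fin n) ℝ → Ξ → Matrix (Fin m) (Fin n) ℝ) (β₁ β₂ α : ℝ)
    (W₁ : Matrix (Fin m) (Fin n) ℝ) (x : ℕ → Fin b → Ξ) (Om : ℕ → Matrix (Fin n) (Fin l) ℝ)
    (t : ℕ) : Matrix (Fin m) (Fin n) ℝ :=
  (state qr svd hk G β₁ β₂ α W₁ x Om (t - 1)).W

/-- The randomness of the algorithm: the samples `ξ t i` are i.i.d. of law `D`, the entries of the
test matrices `Om t` are i.i.d. standard Gaussian, and samples and test matrices are independent. -/
structure IsSampling {n l b : ℕ} {Ω Ξ : Type*} [MeasurableSpace Ω] [MeasurableSpace Ξ]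
    (P : Measure Ω) (D : Measure Ξ) (ξ : ℕ → Fin b → Ω → Ξ)
    (Om : ℕ → Ω → Matrix (Fin n) (Fin l) ℝ) : Prop where
  measurable_sample : ∀ t i, Measurable (ξ t i)
  law_sample : ∀ t i, P.map (ξ t i) = D
  indep_samples : iIndepFun (fun (q : ℕ × Fin b) ω => ξ q.1 q.2 ω) P
  measurable_test : ∀ t, Measurable (Om t)
  law_test : ∀ t i j, P.map (fun ω => Om t ω i j) = gaussianReal 0 1
  indep_tests : iIndepFun (fun (q : ℕ × Fin n × Fin l) ω => Om q.1 ω q.2.1 q.2.2) P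
  indep : IndepFun (fun ω (q : ℕ × Fin b) => ξ q.1 q.2 ω) (fun ω t => Om t ω) P

/-- The constant `γ = (1 + r / (p - 1))^{1/2}`. -/
def gam (r p : ℕ) : ℝ := Real.sqrt (1 + (r : ℝ) / ((p : ℝ) - 1))

/-- `(1 / T) ∑_{t = 1}^{T} E ‖∇f(W_t)‖_{1,1}` for random weights `W`. -/
def avgGrad {m n : ℕ} {Ω : Type*} [MeasurableSpace Ω] (P : Measure Ω)
    (f : Matrix (Fin m) (Fin n) ℝ → ℝ) (W : ℕ → Ω → Matrix (Fin m) (Fin n) ℝ) (T : ℕ) : ℝ :=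
  (1 / (T : ℝ)) * ∑ t ∈ Finset.Icc 1 T, ∫ ω, l1Norm (grad f (W t ω)) ∂P

end MLorc

end

/-!
The bounds follow from a pathwise descent estimate for the sign steps. It uses one property of the
randomized SVD, `norm_rsvd_reconstruct_le`: its output is built from orthogonal projections of the
input and from leading singular triples, so its Frobenius norm is at most that of the input,
whatever the test matrix. No estimate of the approximation error is needed, because
`β₁ ≤ 1 / (4 γ √d)` makes the momentum a small perturbation of the direction `c_t`.

For real numbers `a`, `c` one has `-a sign c ≤ |a - c|` and `|a| - a sign c ≤ 2 |a - c|`. The mean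
of the two, applied entrywise to the gradient `∇f(W_t)` and `c_t / (1 - β₁)`, bounds the decrease
of `f` in one step from below by
`α (‖∇f(W_t)‖₁₁ / 2 - (2 / 5) ‖m̃_{t-1}‖_F - (3 / 2) √d ‖g_t - ∇f(W_t)‖_F) - d L α²`
(`LSmooth.sign_step_le`). Since the randomized SVD does not increase norms, `‖m̃_t‖_F` is dominated
by an exponential moving average of `‖∇f(W_t)‖_F + ‖g_t - ∇f(W_t)‖_F`, so that its sum over the
trajectory is at most the sum of these (`sum_le_sum_of_moving_average`) and is absorbed by the
gradient terms, of which `1 / 10` remains (`LSmooth.sum_l1Norm_grad_le`).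

It remains to take expectations. The current mini-batch is independent of the current weights,
because these are a function of the earlier mini-batches and of the test matrices
(`IsSampling.indepFun_state_batch`), so `E ‖g_t - ∇f(W_t)‖_F ≤ σ / √b`
(`IsStochasticGradient.integral_norm_error_le`). The weights stay within an entrywise distance
`t α` of `W₁`, so everything continuous in them is integrable. The result, `mul_avgGrad_le`, is
`avg ≤ 10 ((f(W₁) - E f(W_{T+1})) / (α T) + (8 / 5) √d σ / √b + d L α)`.
As the first term may be negative, enlarging the outer constant `10` does not make up for the inner
constants; the noise terms of part (a) have to dominate `(8 / 5) √d σ / √b` with factor one, which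
is why the factor `8 / 5` matters and the mean of the two sign inequalities is used in place of the
second one alone (`noise_terms_ge`). Parts (b) and (c) hold with the absolute constant `1600`: the
average in (b) is at most `20` times the bracket, and `1600 = 40²` leaves room for `ε` in (c).
-/

namespace MLorc

variable {m n l k b : ℕ}

/-! ### Frobenius and entrywise norms -/

lemma frobenius_norm_sq (A : Matrix (Fin m) (Fin n) ℝ) : ‖A‖ ^ 2 = ∑ i, ∑ j, A i j ^ 2 := by
  have h : 0 ≤ ∑ i, ∑ j, A i j ^ 2 := by positivity
  rw [Matrix.frobenius_norm_def, ← Real.sqrt_eq_rpow]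
  simp [Real.sq_sqrt h]

lemma frobenius_norm_sq_eq_trace (A : Matrix (Fin m) (Fin n) ℝ) : ‖A‖ ^ 2 = (Aᵀ * A).trace := by
  rw [frobenius_norm_sq, Finset.sum_comm]
  simp [Matrix.trace, Matrix.mul_apply, sq]

lemma sum_mul_le_norm_mul_norm (A B : Matrix (Fin m) (Fin n) ℝ) :
    ∑ i, ∑ j, A i j * B i j ≤ ‖A‖ * ‖B‖ := by
  refine abs_le_of_sq_le_sq' ?_ (by positivity) |>.2
  rw [mul_pow, frobenius_norm_sq, frobenius_norm_sq]
  simp only [← Finset.sum_product']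
  exact Finset.sum_mul_sq_le_sq_mul_sq _ _ _

lemma l1Norm_le_sqrt_mul_norm (A : Matrix (Fin m) (Fin n) ℝ) :
    l1Norm A ≤ √((m : ℝ) * n) * ‖A‖ := by
  refine abs_le_of_sq_le_sq' ?_ (by positivity) |>.2
  rw [mul_pow, frobenius_norm_sq, Real.sq_sqrt (by positivity), l1Norm]
  simp only [← Finset.sum_product']
  simpa using sq_sum_le_card_mul_sum_sq (s := (Finset.univ ×ˢ Finset.univ : Finset (Fin m × Fin n)))
    (f := fun q => |A q.1 q.2|)

lemma l1Norm_nonneg (A : Matrix (Fin m) (Fin n) ℝ) : 0 ≤ l1Norm A := by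
  unfold l1Norm; positivity

lemma norm_le_l1Norm (A : Matrix (Fin m) (Fin n) ℝ) : ‖A‖ ≤ l1Norm A := by
  refine abs_le_of_sq_le_sq' ?_ (l1Norm_nonneg A) |>.2
  rw [frobenius_norm_sq, l1Norm]
  simp only [← Finset.sum_product', ← sq_abs (A _ _)]
  exact Finset.sum_sq_le_sq_sum_of_nonneg fun _ _ => abs_nonneg _

lemma norm_map_sign_le (A : Matrix (Fin m) (Fin n) ℝ) :
    ‖A.map Real.sign‖ ≤ √((m : ℝ) * n) := by
  refine Real.le_sqrt_of_sq_le ?_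
  rw [frobenius_norm_sq]
  have h : ∀ i j, (A.map Real.sign) i j ^ 2 ≤ 1 := fun i j => by
    rcases Real.sign_apply_eq (A i j) with h | h | h <;> simp [h]
  calc _ ≤ ∑ i : Fin m, ∑ j : Fin n, (1 : ℝ) :=
        Finset.sum_le_sum fun i _ => Finset.sum_le_sum fun j _ => h i j
    _ = _ := by simp

/-! ### The randomized SVD does not increase the Frobenius norm -/

lemma norm_mul_of_orthonormal {U : Matrix (Fin m) (Fin l) ℝ} (hU : Uᵀ * U = 1)
    (A : Matrix (Fin l) (Fin n) ℝ) : ‖U * A‖ = ‖A‖ := by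
  rw [← sq_eq_sq₀ (norm_nonneg _) (norm_nonneg _), frobenius_norm_sq_eq_trace,
    frobenius_norm_sq_eq_trace, Matrix.transpose_mul, Matrix.mul_assoc, ← Matrix.mul_assoc Uᵀ, hU,
    Matrix.one_mul]

/-- Multiplication by the transpose of a matrix with orthonormal columns does not increase the
Frobenius norm, since `‖Uᵀ A‖² = ⟨A, U Uᵀ A⟩ ≤ ‖A‖ ‖Uᵀ A‖`. -/
lemma norm_transpose_mul_le_of_orthonormal {U : Matrix (Fin m) (Fin l) ℝ} (hU : Uᵀ * U = 1)
    (A : Matrix (Fin m) (Fin n) ℝ) : ‖Uᵀ * A‖ ≤ ‖A‖ := by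
  have h : ‖Uᵀ * A‖ ^ 2 ≤ ‖A‖ * ‖Uᵀ * A‖ := by
    rw [frobenius_norm_sq_eq_trace, ← norm_mul_of_orthonormal hU (Uᵀ * A)]
    convert sum_mul_le_norm_mul_norm A (U * (Uᵀ * A)) using 1
    rw [Finset.sum_comm, Matrix.transpose_mul, Matrix.transpose_transpose, Matrix.mul_assoc]
    rw [Matrix.trace]
    simp only [Matrix.diag_apply, Matrix.mul_apply (M := Aᵀ), Matrix.transpose_apply]
  nlinarith [norm_nonneg A, norm_nonneg (Uᵀ * A)]

lemma submatrix_orthonormal {U : Matrix (Fin m) (Fin l) ℝ} (hU : Uᵀ * U = 1) (hk : k ≤ l) :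
    (U.submatrix id (Fin.castLE hk))ᵀ * U.submatrix id (Fin.castLE hk) = 1 := by
  ext i j
  have := congrFun (congrFun hU (Fin.castLE hk i)) (Fin.castLE hk j)
  simpa [Matrix.mul_apply, Matrix.one_apply] using this

lemma norm_diagonal_castLE_le (hk : k ≤ l) (s : Fin l → ℝ) :
    ‖Matrix.diagonal fun j : Fin k => s (Fin.castLE hk j)‖ ≤ ‖Matrix.diagonal s‖ := by
  rw [← sq_le_sq₀ (norm_nonneg _) (norm_nonneg _), frobenius_norm_sq_eq_trace,
    frobenius_norm_sq_eq_trace]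
  simp only [Matrix.diagonal_transpose, Matrix.diagonal_mul_diagonal, Matrix.trace_diagonal]
  refine (Finset.sum_map Finset.univ (Fin.castLEEmb hk) fun i => s i * s i).symm.trans_le ?_
  exact Finset.sum_le_sum_of_subset_of_nonneg (Finset.subset_univ _)
    fun i _ _ => mul_self_nonneg _

lemma norm_mul_transpose_of_orthonormal {V : Matrix (Fin n) (Fin l) ℝ} (hV : Vᵀ * V = 1)
    (A : Matrix (Fin m) (Fin l) ℝ) : ‖A * Vᵀ‖ = ‖A‖ := by
  rw [← Matrix.frobenius_norm_transpose, Matrix.transpose_mul, Matrix.transpose_transpose,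
    norm_mul_of_orthonormal hV, Matrix.frobenius_norm_transpose]

/-- The matrix returned by the randomized SVD has Frobenius norm at most that of the input, for
every value of the test matrix: its squared norm is the sum of the squares of the `k` leading
singular values of `Qᵀ A`. -/
lemma norm_rsvd_reconstruct_le (qr : QRRoutine m l) (svd : SVDRoutine l n) (hk : k ≤ l)
    (A : Matrix (Fin m) (Fin n) ℝ) (Om : Matrix (Fin n) (Fin l) ℝ) :
    ‖(rsvd qr svd hk A Om).reconstruct‖ ≤ ‖A‖ := by
  set Q := qr.Q (A * Om) with hQ
  set B := Qᵀ * A with hB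
  have hQU : (Q * svd.U B)ᵀ * (Q * svd.U B) = 1 := by
    rw [Matrix.transpose_mul, Matrix.mul_assoc, ← Matrix.mul_assoc Qᵀ, qr.orthonormal,
      Matrix.one_mul, svd.orthonormal_U]
  calc ‖(rsvd qr svd hk A Om).reconstruct‖
      = ‖Matrix.diagonal fun j : Fin k => svd.s B (Fin.castLE hk j)‖ := by
        simp only [rsvd, Factors.reconstruct, ← hQ, ← hB]
        rw [norm_mul_transpose_of_orthonormal (submatrix_orthonormal (svd.orthonormal_V B) hk),
          norm_mul_of_orthonormal (submatrix_orthonormal hQU hk)]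
    _ ≤ ‖Matrix.diagonal (svd.s B)‖ := norm_diagonal_castLE_le hk _
    _ = ‖B‖ := by
        conv_rhs => rw [svd.eq_mul B]
        rw [norm_mul_transpose_of_orthonormal (svd.orthonormal_V B),
          norm_mul_of_orthonormal (svd.orthonormal_U B)]
    _ ≤ ‖A‖ := norm_transpose_mul_le_of_orthonormal (qr.orthonormal _) A

/-! ### Smooth functions -/

lemma fderiv_apply_eq_sum_grad (f : Matrix (Fin m) (Fin n) ℝ → ℝ)
    (W V : Matrix (Fin m) (Fin n) ℝ) :
    fderiv ℝ f W V = ∑ i, ∑ j, grad f W i j * V i j := by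
  conv_lhs => rw [Matrix.matrix_eq_sum_single V]
  simp only [map_sum, grad, Matrix.of_apply]
  refine Finset.sum_congr rfl fun i _ => Finset.sum_congr rfl fun j _ => ?_
  rw [mul_comm, ← smul_eq_mul, ← map_smul, Matrix.smul_single, smul_eq_mul, mul_one]

lemma LSmooth.continuous_grad {f : Matrix (Fin m) (Fin n) ℝ → ℝ} {L : ℝ} (hf : LSmooth f L) :
    Continuous (grad f) :=
  (LipschitzWith.of_dist_le_mul (K := L.toNNReal) fun W W' => by
    rw [dist_eq_norm, dist_eq_norm]
    exact (hf.lipschitz W W').trans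
      (mul_le_mul_of_nonneg_right (Real.le_coe_toNNReal L) (norm_nonneg _))).continuous

lemma LSmooth.nonneg [NeZero m] [NeZero n] {f : Matrix (Fin m) (Fin n) ℝ → ℝ} {L : ℝ}
    (hf : LSmooth f L) : 0 ≤ L := by
  have h := (norm_nonneg _).trans (hf.lipschitz (Matrix.single 0 0 1) 0)
  refine nonneg_of_mul_nonneg_left h (norm_pos_iff.2 fun h0 => ?_)
  simpa using congrFun (congrFun h0 0) 0

/-- The descent inequality, with constant `L` in place of the sharp `L / 2`. -/
lemma LSmooth.apply_add_le {f : Matrix (Fin m) (Fin n) ℝ → ℝ} {L : ℝ} (hf : LSmooth f L)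
    (hL : 0 ≤ L) (W V : Matrix (Fin m) (Fin n) ℝ) :
    f (W + V) ≤ f W + ∑ i, ∑ j, grad f W i j * V i j + L * ‖V‖ ^ 2 := by
  have hd : ∀ s : ℝ, HasDerivAt (fun s : ℝ => f (W + s • V)) (fderiv ℝ f (W + s • V) V) s := by
    intro s
    have h1 : HasDerivAt (fun s : ℝ => W + s • V) V s := by
      have h1 := ((hasDerivAt_id s).smul_const V).const_add W
      rwa [one_smul] at h1
    exact (hf.differentiable _).hasFDerivAt.comp_hasDerivAt s h1
  obtain ⟨s, hs, h⟩ := exists_hasDerivAt_eq_slope (fun s : ℝ => f (W + s • V)) _ zero_lt_one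
    (fun s _ => (hd s).continuousAt.continuousWithinAt) (fun s _ => hd s)
  simp only [one_smul, zero_smul, add_zero, sub_zero, div_one, fderiv_apply_eq_sum_grad] at h
  have h2 := sum_mul_le_norm_mul_norm (grad f (W + s • V) - grad f W) V
  have h3 := hf.lipschitz (W + s • V) W
  rw [add_sub_cancel_left, norm_smul, Real.norm_of_nonneg hs.1.le] at h3
  have h4 : ‖grad f (W + s • V) - grad f W‖ ≤ L * ‖V‖ :=
    h3.trans (mul_le_mul_of_nonneg_left (mul_le_of_le_one_left (norm_nonneg _) hs.2.le) hL)
  have h5 := mul_le_mul_of_nonneg_right h4 (norm_nonneg V)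
  simp only [Matrix.sub_apply, sub_mul, Finset.sum_sub_distrib] at h2
  nlinarith

/-- The gradient vanishes at a global minimizer. -/
lemma grad_eq_zero_of_forall_le {f : Matrix (Fin m) (Fin n) ℝ → ℝ}
    {W : Matrix (Fin m) (Fin n) ℝ} (h : ∀ V, f W ≤ f V) : grad f W = 0 := by
  have hmin : IsLocalMin f W := Filter.Eventually.of_forall h
  have h0 : fderiv ℝ f W = 0 := hmin.fderiv_eq_zero
  ext i j
  simp [grad, h0]

/-! ### Measurability of the iterates -/

instance instBorelSpaceRealMatrix : BorelSpace (Matrix (Fin m) (Fin n) ℝ) :=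
  inferInstanceAs (BorelSpace (Fin m → Fin n → ℝ))

section Measurability

variable {A : Type*} [MeasurableSpace A]

lemma measurable_matrix_iff {F : A → Matrix (Fin m) (Fin n) ℝ} :
    Measurable F ↔ ∀ i j, Measurable fun a => F a i j :=
  measurable_pi_iff.trans (forall_congr' fun _ => measurable_pi_iff)

lemma measurable_matrix_entry {F : A → Matrix (Fin m) (Fin n) ℝ} (hF : Measurable F)
    (i : Fin m) (j : Fin n) : Measurable fun a => F a i j :=
  measurable_matrix_iff.1 hF i j

lemma measurable_matrix_mul {F : A → Matrix (Fin m) (Fin l) ℝ} {F' : A → Matrix (Fin l) (Fin n) ℝ}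
    (hF : Measurable F) (hF' : Measurable F') : Measurable fun a => F a * F' a := by
  refine measurable_matrix_iff.2 fun i j => ?_
  simp only [Matrix.mul_apply]
  exact Finset.measurable_fun_sum _ fun q _ =>
    (measurable_matrix_entry hF i q).mul (measurable_matrix_entry hF' q j)

lemma measurable_matrix_transpose {F : A → Matrix (Fin m) (Fin n) ℝ} (hF : Measurable F) :
    Measurable fun a => (F a)ᵀ :=
  measurable_matrix_iff.2 fun i j => measurable_matrix_entry hF j i

lemma measurable_frobenius_norm {F : A → Matrix (Fin m) (Fin n) ℝ} (hF : Measurable F) :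
    Measurable fun a => ‖F a‖ := by
  have h : Continuous fun X : Matrix (Fin m) (Fin n) ℝ => ‖X‖ := continuous_norm
  exact h.measurable.comp hF

lemma measurable_real_sign : Measurable Real.sign :=
  Measurable.ite measurableSet_Iio measurable_const
    (Measurable.ite measurableSet_Ioi measurable_const measurable_const)

lemma measurable_rsvd_reconstruct (qr : QRRoutine m l) (svd : SVDRoutine l n) (hk : k ≤ l)
    {F : A → Matrix (Fin m) (Fin n) ℝ} {H : A → Matrix (Fin n) (Fin l) ℝ}
    (hF : Measurable F) (hH : Measurable H) :
    Measurable fun a => (rsvd qr svd hk (F a) (H a)).reconstruct := by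
  have hQ : Measurable fun a => qr.Q (F a * H a) :=
    qr.measurable_Q.comp (measurable_matrix_mul hF hH)
  have hB : Measurable fun a => (qr.Q (F a * H a))ᵀ * F a :=
    measurable_matrix_mul (measurable_matrix_transpose hQ) hF
  have hU := measurable_matrix_mul hQ (svd.measurable_U.comp hB)
  have hs := svd.measurable_s.comp hB
  have hV := svd.measurable_V.comp hB
  refine measurable_matrix_mul (measurable_matrix_mul ?_ ?_) (measurable_matrix_transpose ?_)
  · exact measurable_matrix_iff.2 fun i j => measurable_matrix_entry hU i _
  · refine measurable_matrix_iff.2 fun i j => ?_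
    simp only [rsvd, Matrix.diagonal_apply]
    split_ifs
    · exact measurable_pi_iff.1 hs _
    · exact measurable_const
  · exact measurable_matrix_iff.2 fun i j => measurable_matrix_entry hV i _

variable {Ξ : Type*} [MeasurableSpace Ξ]
  {G : Matrix (Fin m) (Fin n) ℝ → Ξ → Matrix (Fin m) (Fin n) ℝ}

lemma measurable_batchGrad
    (hG : Measurable fun q : Matrix (Fin m) (Fin n) ℝ × Ξ => G q.1 q.2)
    {F : A → Matrix (Fin m) (Fin n) ℝ} {x : Fin b → A → Ξ} (hF : Measurable F)
    (hx : ∀ i, Measurable (x i)) : Measurable fun a => batchGrad G (F a) fun i => x i a := by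
  refine measurable_matrix_iff.2 fun i j => ?_
  simp only [batchGrad, Matrix.smul_apply, Matrix.sum_apply, smul_eq_mul]
  exact (Finset.measurable_fun_sum _ fun q _ =>
    measurable_matrix_entry (hG.comp (hF.prodMk (hx q))) i j).const_mul _

/-- The state after `t` iterations is measurable with respect to any σ-algebra that makes the
first `t` mini-batches and the first `t` test matrices measurable. -/
lemma measurable_state (qr : QRRoutine m l) (svd : SVDRoutine l n) (hk : k ≤ l)
    (hG : Measurable fun q : Matrix (Fin m) (Fin n) ℝ × Ξ => G q.1 q.2) (β₁ β₂ α : ℝ)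
    (W₁ : Matrix (Fin m) (Fin n) ℝ) {x : ℕ → Fin b → A → Ξ}
    {H : ℕ → A → Matrix (Fin n) (Fin l) ℝ} (t : ℕ)
    (hx : ∀ s < t, ∀ i, Measurable (x s i)) (hH : ∀ s < t, Measurable (H s)) :
    Measurable (fun a => (state qr svd hk G β₁ β₂ α W₁ (fun s i => x s i a)
      (fun s => H s a) t).W) ∧
    Measurable fun a => (state qr svd hk G β₁ β₂ α W₁ (fun s i => x s i a)
      (fun s => H s a) t).mom.reconstruct := by
  induction t with
  | zero =>
    exact ⟨measurable_const, measurable_const (a := ((0 : Matrix (Fin m) (Fin k) ℝ) * 0 * 0ᵀ))⟩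
  | succ t ih =>
    obtain ⟨hW, hM⟩ := ih (fun s hs => hx s (hs.trans t.lt_succ_self))
      fun s hs => hH s (hs.trans t.lt_succ_self)
    have hg := measurable_batchGrad hG hW (hx t t.lt_succ_self)
    have hcomb : ∀ β : ℝ, Measurable fun a =>
        β • (state qr svd hk G β₁ β₂ α W₁ (fun s i => x s i a) (fun s => H s a) t).mom.reconstruct
        + (1 - β) • batchGrad G (state qr svd hk G β₁ β₂ α W₁ (fun s i => x s i a)
          (fun s => H s a) t).W fun i => x t i a := fun β =>
      measurable_matrix_iff.2 fun i j =>
        ((measurable_matrix_entry hM i j).const_mul β).add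
          ((measurable_matrix_entry hg i j).const_mul (1 - β))
    refine ⟨measurable_matrix_iff.2 fun i j => ?_,
      measurable_rsvd_reconstruct qr svd hk (hcomb β₂) (hH t t.lt_succ_self)⟩
    exact (measurable_matrix_entry hW i j).sub
      ((measurable_real_sign.comp (measurable_matrix_entry (hcomb β₁) i j)).const_mul α)

end Measurability

/-! ### Independence of the mini-batch from the past -/

lemma indepFun_prodMk_of_indepFun_prodMk {Ω A B C : Type*} [MeasurableSpace Ω] [MeasurableSpace A]
    [MeasurableSpace B] [MeasurableSpace C] {P : Measure Ω} [IsProbabilityMeasure P]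
    {X : Ω → A} {Y : Ω → B} {Z : Ω → C} (hX : Measurable X) (hY : Measurable Y) (hZ : Measurable Z)
    (hXY : IndepFun X Y P) (h : IndepFun (fun ω => (X ω, Y ω)) Z P) :
    IndepFun X (fun ω => (Y ω, Z ω)) P := by
  have := Measure.isProbabilityMeasure_map (μ := P) hX.aemeasurable
  have := Measure.isProbabilityMeasure_map (μ := P) hY.aemeasurable
  have := Measure.isProbabilityMeasure_map (μ := P) hZ.aemeasurable
  have hYZ : IndepFun Y Z P := h.comp measurable_snd measurable_id
  rw [indepFun_iff_map_prod_eq_prod_map_map hX.aemeasurable (hY.prodMk hZ).aemeasurable,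
    (indepFun_iff_map_prod_eq_prod_map_map hY.aemeasurable hZ.aemeasurable).1 hYZ,
    ← Measure.prodAssoc_prod,
    ← (indepFun_iff_map_prod_eq_prod_map_map hX.aemeasurable hY.aemeasurable).1 hXY,
    ← (indepFun_iff_map_prod_eq_prod_map_map (hX.prodMk hY).aemeasurable hZ.aemeasurable).1 h,
    Measure.map_map MeasurableEquiv.prodAssoc.measurable ((hX.prodMk hY).prodMk hZ)]
  rfl

section Sampling

variable {Ω Ξ : Type*} [MeasurableSpace Ω] [MeasurableSpace Ξ] {P : Measure Ω} {D : Measure Ξ}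
  {ξ : ℕ → Fin b → Ω → Ξ} {Om : ℕ → Ω → Matrix (Fin n) (Fin l) ℝ}

lemma IsSampling.map_batch [IsProbabilityMeasure P] (h : IsSampling P D ξ Om) (t : ℕ) :
    P.map (fun ω i => ξ t i ω) = Measure.pi fun _ : Fin b => D := by
  have h1 : iIndepFun (fun i : Fin b => ξ t i) P :=
    h.indep_samples.precomp (g := fun i : Fin b => (t, i)) fun i j hij => (Prod.ext_iff.1 hij).2
  rw [h1.map_fun_eq_pi_map fun i => (h.measurable_sample t i).aemeasurable]
  simp only [h.law_sample]

/-- The mini-batch of an iteration is independent of the earlier mini-batches together with all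
the test matrices. -/
lemma IsSampling.indepFun_batch_past [IsProbabilityMeasure P] (h : IsSampling P D ξ Om) (t : ℕ) :
    IndepFun (fun ω i => ξ t i ω)
      (fun ω => ((fun q : ↥(Finset.range t ×ˢ (Finset.univ : Finset (Fin b))) =>
        ξ q.1.1 q.1.2 ω), fun s => Om s ω)) P := by
  have hξ : Measurable fun ω i => ξ t i ω := measurable_pi_iff.2 (h.measurable_sample t)
  have hpast : Measurable fun ω => fun q : ↥(Finset.range t ×ˢ (Finset.univ : Finset (Fin b))) =>
      ξ q.1.1 q.1.2 ω := measurable_pi_iff.2 fun q => h.measurable_sample _ _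
  refine indepFun_prodMk_of_indepFun_prodMk hξ hpast (measurable_pi_iff.2 h.measurable_test) ?_ ?_
  · have hd : Disjoint ({t} ×ˢ (Finset.univ : Finset (Fin b)))
        (Finset.range t ×ˢ (Finset.univ : Finset (Fin b))) := by
      rw [Finset.disjoint_left]
      intro q hq hq'
      simp only [Finset.mem_product, Finset.mem_singleton, Finset.mem_range] at hq hq'
      omega
    exact (h.indep_samples.indepFun_finset _ _ hd fun q => h.measurable_sample q.1 q.2).comp
      (φ := fun y (i : Fin b) => y ⟨(t, i), by simp⟩) (ψ := id)
      (measurable_pi_iff.2 fun i => measurable_pi_apply _) measurable_id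
  · exact h.indep.comp (φ := fun y : ℕ × Fin b → Ξ => ((fun i : Fin b => y (t, i)),
        fun q : ↥(Finset.range t ×ˢ (Finset.univ : Finset (Fin b))) => y q.1)) (ψ := id)
      (by fun_prop) measurable_id

lemma IsSampling.indepFun_state_batch {G : Matrix (Fin m) (Fin n) ℝ → Ξ → Matrix (Fin m) (Fin n) ℝ}
    [IsProbabilityMeasure P] (h : IsSampling P D ξ Om) (qr : QRRoutine m l) (svd : SVDRoutine l n) (hk : k ≤ l)
    (hG : Measurable fun q : Matrix (Fin m) (Fin n) ℝ × Ξ => G q.1 q.2) (β₁ β₂ α : ℝ)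
    (W₁ : Matrix (Fin m) (Fin n) ℝ) (t : ℕ) :
    IndepFun (fun ω => (state qr svd hk G β₁ β₂ α W₁ (fun s i => ξ s i ω)
      (fun s => Om s ω) t).W) (fun ω i => ξ t i ω) P := by
  set past := fun ω => ((fun q : ↥(Finset.range t ×ˢ (Finset.univ : Finset (Fin b))) =>
        ξ q.1.1 q.1.2 ω), fun s => Om s ω) with hpast
  have h1 : Indep (MeasurableSpace.comap past inferInstance) _ P :=
    (IndepFun_iff_Indep _ _ _).1 (h.indepFun_batch_past t).symm
  refine (IndepFun_iff_Indep _ _ _).2 (indep_of_indep_of_le_left h1 ?_)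
  refine Measurable.comap_le (@measurable_state m n l k b Ω
    (MeasurableSpace.comap past inferInstance) Ξ _ G qr svd hk hG β₁ β₂ α W₁ ξ Om t ?_ ?_).1
  · intro s hs i
    exact (measurable_pi_apply (⟨(s, i), by simpa using hs⟩ :
      ↥(Finset.range t ×ˢ (Finset.univ : Finset (Fin b))))).comp
      (measurable_fst.comp (comap_measurable past))
  · intro s _
    exact (measurable_pi_apply s).comp (measurable_snd.comp (comap_measurable past))

end Sampling

/-! ### Variance of the mini-batch gradient -/

lemma batchGrad_sub_apply {Ξ : Type*} {f : Matrix (Fin m) (Fin n) ℝ → ℝ}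
    {G : Matrix (Fin m) (Fin n) ℝ → Ξ → Matrix (Fin m) (Fin n) ℝ} (hb : 1 ≤ b) (w : Matrix (Fin m) (Fin n) ℝ) (x : Fin b → Ξ)
    (i : Fin m) (j : Fin n) : (batchGrad G w x - grad f w) i j =
      (1 / (b : ℝ)) * ∑ q, (G w (x q) i j - grad f w i j) := by
  have : (b : ℝ) ≠ 0 := by positivity
  simp only [batchGrad, Matrix.sub_apply, Matrix.smul_apply, Matrix.sum_apply, smul_eq_mul,
    Finset.sum_sub_distrib, Finset.sum_const, Finset.card_univ, Fintype.card_fin, nsmul_eq_mul]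
  field_simp

section Variance

variable {Ω Ξ : Type*} [MeasurableSpace Ω] [MeasurableSpace Ξ] {D : Measure Ξ}
  {f : Matrix (Fin m) (Fin n) ℝ → ℝ}
  {G : Matrix (Fin m) (Fin n) ℝ → Ξ → Matrix (Fin m) (Fin n) ℝ} {σ : ℝ}

lemma IsStochasticGradient.memLp_entry [IsFiniteMeasure D] (hG : IsStochasticGradient f G D σ)
    (w : Matrix (Fin m) (Fin n) ℝ) (i : Fin m) (j : Fin n) :
    MemLp (fun x => G w x i j - grad f w i j) 2 D := by
  have hm : AEStronglyMeasurable (fun x => G w x i j - grad f w i j) D :=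
    (hG.integrable w i j).aestronglyMeasurable.sub aestronglyMeasurable_const
  refine (memLp_two_iff_integrable_sq hm).2 ((hG.integrable_sq w).mono' (hm.pow 2) ?_)
  refine Filter.Eventually.of_forall fun x => ?_
  rw [Real.norm_of_nonneg (sq_nonneg _), frobenius_norm_sq]
  have h1 : ∑ j', (G w x - grad f w) i j' ^ 2 ≤ _ := Finset.single_le_sum
    (f := fun i => ∑ j, (G w x - grad f w) i j ^ 2) (fun _ _ => by positivity) (Finset.mem_univ i)
  exact (Finset.single_le_sum (f := fun j => (G w x - grad f w) i j ^ 2)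
    (fun _ _ => sq_nonneg _) (Finset.mem_univ j)).trans h1

/-- Averaging `b` independent stochastic gradients divides the variance by `b`. -/
lemma IsStochasticGradient.batch_variance [IsProbabilityMeasure D] (hG : IsStochasticGradient f G D σ) (hb : 1 ≤ b)
    (w : Matrix (Fin m) (Fin n) ℝ) :
    Integrable (fun x => ‖batchGrad G w x - grad f w‖ ^ 2) (Measure.pi fun _ : Fin b => D) ∧
    ∫ x, ‖batchGrad G w x - grad f w‖ ^ 2 ∂(Measure.pi fun _ : Fin b => D) ≤ σ ^ 2 / b := by
  have hb0 : (b : ℝ) ≠ 0 := by positivity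
  have hcomp : ∀ i j (q : Fin b), MemLp (fun x : Fin b → Ξ => G w (x q) i j - grad f w i j) 2
      (Measure.pi fun _ : Fin b => D) := fun i j q =>
    (hG.memLp_entry w i j).comp_measurePreserving (measurePreserving_eval (fun _ : Fin b => D) q)
  have hsq : ∀ i j, Integrable (fun x => (G w x - grad f w) i j ^ 2) D := fun i j =>
    (hG.memLp_entry w i j).integrable_sq
  have hmem : ∀ i j, MemLp (∑ q : Fin b, fun x : Fin b → Ξ => G w (x q) i j - grad f w i j) 2
      (Measure.pi fun _ : Fin b => D) := fun i j => memLp_finsetSum' _ fun q _ =>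
    hcomp i j q
  have hint : ∀ i j, Integrable (fun x : Fin b → Ξ => (batchGrad G w x - grad f w) i j ^ 2)
      (Measure.pi fun _ : Fin b => D) := fun i j => by
    simp only [batchGrad_sub_apply hb, mul_pow]
    refine Integrable.const_mul ?_ _
    simpa only [Finset.sum_apply] using (hmem i j).integrable_sq
  have hmean : ∀ i j, ∫ x, (G w x i j - grad f w i j) ∂D = 0 := fun i j => by
    rw [integral_sub (hG.integrable w i j) (integrable_const _), hG.unbiased]
    simp
  have hval : ∀ i j, ∫ x, (batchGrad G w x - grad f w) i j ^ 2 ∂(Measure.pi fun _ : Fin b => D)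
      = (1 / (b : ℝ)) * ∫ x, (G w x - grad f w) i j ^ 2 ∂D := fun i j => by
    have hm0 : ∫ x, (∑ q : Fin b, fun x : Fin b → Ξ => G w (x q) i j - grad f w i j) x
        ∂(Measure.pi fun _ : Fin b => D) = 0 := by
      simp only [Finset.sum_apply]
      rw [integral_finsetSum _ fun q _ => (hcomp i j q).integrable one_le_two]
      refine Finset.sum_eq_zero fun q _ => ?_
      rw [integral_comp_eval (μ := fun _ : Fin b => D) (i := q)
        (f := fun x => G w x i j - grad f w i j)
        (hG.memLp_entry w i j).aestronglyMeasurable, hmean]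
    have hv := variance_sum_pi (μ := fun _ : Fin b => D) fun _ => hG.memLp_entry w i j
    rw [variance_of_integral_eq_zero (hmem i j).aestronglyMeasurable.aemeasurable hm0,
      variance_of_integral_eq_zero (hG.memLp_entry w i j).aestronglyMeasurable.aemeasurable
        (hmean i j)] at hv
    simp only [Finset.sum_apply, Finset.sum_const, Finset.card_univ, Fintype.card_fin,
      nsmul_eq_mul] at hv
    simp only [batchGrad_sub_apply hb, mul_pow]
    rw [integral_const_mul, hv]
    simp only [Matrix.sub_apply]
    field_simp
  constructor
  · simp only [frobenius_norm_sq]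
    exact integrable_finsetSum _ fun i _ => integrable_finsetSum _ fun j _ => hint i j
  · have h1 : ∑ i, ∑ j, ∫ x, (G w x - grad f w) i j ^ 2 ∂D ≤ σ ^ 2 := by
      have h := hG.variance_le w
      simp only [frobenius_norm_sq] at h
      rw [integral_finsetSum _ fun i _ => integrable_finsetSum _ fun j _ => hsq i j] at h
      refine le_of_eq_of_le (Finset.sum_congr rfl fun i _ => ?_) h
      exact (integral_finsetSum _ fun j _ => hsq i j).symm
    simp only [frobenius_norm_sq]
    rw [integral_finsetSum _ fun i _ => integrable_finsetSum _ fun j _ => hint i j]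
    calc _ = ∑ i, ∑ j, (1 / (b : ℝ)) * ∫ x, (G w x - grad f w) i j ^ 2 ∂D :=
          Finset.sum_congr rfl fun i _ => (integral_finsetSum _ fun j _ => hint i j).trans
            (Finset.sum_congr rfl fun j _ => hval i j)
      _ = (1 / (b : ℝ)) * ∑ i, ∑ j, ∫ x, (G w x - grad f w) i j ^ 2 ∂D := by
          simp only [Finset.mul_sum]
      _ ≤ (1 / (b : ℝ)) * σ ^ 2 := mul_le_mul_of_nonneg_left h1 (by positivity)
      _ = σ ^ 2 / b := by ring

/-- Jensen's inequality after conditioning on one of two independent variables: a conditional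
second moment that is at most `c` everywhere bounds the first moment by `√c`. -/
lemma integral_le_sqrt_of_indepFun {A B : Type*} [MeasurableSpace A] [MeasurableSpace B]
    {P : Measure Ω} [IsProbabilityMeasure P] {ν : Measure B} [SFinite ν] {Φ : A → B → ℝ} {c : ℝ}
    (hc : 0 ≤ c) (hΦ : Measurable fun q : A × B => Φ q.1 q.2) {X : Ω → A} {Y : Ω → B}
    (hX : Measurable X) (hY : Measurable Y) (hlaw : P.map Y = ν) (hXY : IndepFun X Y P)
    (hbound : ∀ w, Integrable (fun y => Φ w y ^ 2) ν ∧ ∫ y, Φ w y ^ 2 ∂ν ≤ c) :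
    Integrable (fun ω => Φ (X ω) (Y ω)) P ∧ ∫ ω, Φ (X ω) (Y ω) ∂P ≤ √c := by
  have hm : Measurable fun ω => Φ (X ω) (Y ω) := hΦ.comp (hX.prodMk hY)
  have := Measure.isProbabilityMeasure_map (μ := P) hX.aemeasurable
  have hl : ∫⁻ ω, ENNReal.ofReal (Φ (X ω) (Y ω) ^ 2) ∂P ≤ ENNReal.ofReal c := by
    have hΦ2 := (hΦ.pow_const 2).ennreal_ofReal
    rw [← lintegral_map (μ := P) hΦ2 (hX.prodMk hY),
      (indepFun_iff_map_prod_eq_prod_map_map hX.aemeasurable hY.aemeasurable).1 hXY,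
      hlaw, lintegral_prod _ hΦ2.aemeasurable]
    calc _ ≤ ∫⁻ _, ENNReal.ofReal c ∂(P.map X) := by
          refine lintegral_mono fun w => ?_
          rw [← ofReal_integral_eq_lintegral_ofReal (hbound w).1
            (Filter.Eventually.of_forall fun _ => sq_nonneg _)]
          exact ENNReal.ofReal_le_ofReal (hbound w).2
      _ = _ := by simp
  have hi2 : Integrable (fun ω => Φ (X ω) (Y ω) ^ 2) P := by
    refine ⟨(hm.pow_const 2).aestronglyMeasurable, ?_⟩
    rw [hasFiniteIntegral_iff_ofReal (Filter.Eventually.of_forall fun _ => sq_nonneg _)]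
    exact hl.trans_lt ENNReal.ofReal_lt_top
  have hmem := (memLp_two_iff_integrable_sq hm.aestronglyMeasurable).2 hi2
  refine ⟨hmem.integrable one_le_two, ?_⟩
  rw [← ofReal_integral_eq_lintegral_ofReal hi2
    (Filter.Eventually.of_forall fun _ => sq_nonneg _), ENNReal.ofReal_le_ofReal_iff hc] at hl
  have h3 := variance_nonneg (fun ω => Φ (X ω) (Y ω)) P
  rw [variance_eq_sub hmem] at h3
  refine Real.le_sqrt_of_sq_le ?_
  simp only [Pi.pow_apply] at h3
  linarith

/-- The expected Frobenius error of a mini-batch gradient at a random point independent of the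
mini-batch is at most `σ / √b`. -/
lemma IsStochasticGradient.integral_norm_error_le {P : Measure Ω} [IsProbabilityMeasure P]
    [IsProbabilityMeasure D] (hG : IsStochasticGradient f G D σ) (hgrad : Measurable (grad f))
    (hσ : 0 ≤ σ) (hb : 1 ≤ b) {X : Ω → Matrix (Fin m) (Fin n) ℝ} {Y : Ω → Fin b → Ξ}
    (hX : Measurable X) (hY : Measurable Y)
    (hlaw : P.map Y = Measure.pi fun _ : Fin b => D) (hXY : IndepFun X Y P) :
    Integrable (fun ω => ‖batchGrad G (X ω) (Y ω) - grad f (X ω)‖) P ∧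
    ∫ ω, ‖batchGrad G (X ω) (Y ω) - grad f (X ω)‖ ∂P ≤ σ / √(b : ℝ) := by
  have h1 : Measurable fun q : Matrix (Fin m) (Fin n) ℝ × (Fin b → Ξ) => batchGrad G q.1 q.2 :=
    measurable_batchGrad hG.measurable measurable_fst
      (x := fun i (q : Matrix (Fin m) (Fin n) ℝ × (Fin b → Ξ)) => q.2 i)
      fun i => (measurable_pi_apply i).comp measurable_snd
  have h2 : Measurable fun q : Matrix (Fin m) (Fin n) ℝ × (Fin b → Ξ) => grad f q.1 :=
    hgrad.comp measurable_fst
  have h3 : Measurable fun q : Matrix (Fin m) (Fin n) ℝ × (Fin b → Ξ) =>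
      batchGrad G q.1 q.2 - grad f q.1 := measurable_matrix_iff.2 fun i j =>
    (measurable_matrix_entry h1 i j).sub (measurable_matrix_entry h2 i j)
  have h := integral_le_sqrt_of_indepFun (Φ := fun w y => ‖batchGrad G w y - grad f w‖)
    (c := σ ^ 2 / b) (by positivity) (measurable_frobenius_norm h3) hX hY hlaw hXY
    fun w => hG.batch_variance hb w
  rwa [Real.sqrt_div (sq_nonneg σ), Real.sqrt_sq hσ] at h

end Variance

/-! ### One iteration -/

/-- The average, with equal weights, of `0 ≤ a sign c + |a - c|` and
`|a| ≤ a sign c + 2 |a - c|`. -/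
lemma half_abs_sub_le_mul_sign (a c : ℝ) : |a| / 2 - 3 / 2 * |a - c| ≤ a * Real.sign c := by
  rcases lt_trichotomy c 0 with h | h | h
  · rw [Real.sign_of_neg h]
    cases abs_cases a <;> cases abs_cases (a - c) <;> linarith
  · rw [h, Real.sign_zero, sub_zero]
    linarith [abs_nonneg a]
  · rw [Real.sign_of_pos h]
    cases abs_cases a <;> cases abs_cases (a - c) <;> linarith

lemma sum_mul_sign_ge (A M g : Matrix (Fin m) (Fin n) ℝ) {β₁ : ℝ} (hβ₁ : 0 ≤ β₁) (hβ₁' : β₁ < 1) :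
    (1 - β₁) * (l1Norm A / 2) - 3 / 2 * (β₁ * l1Norm M + (1 - β₁) * l1Norm (g - A)) ≤
      (1 - β₁) * ∑ i, ∑ j, A i j * ((β₁ • M + (1 - β₁) • g).map Real.sign) i j := by
  simp only [l1Norm, Finset.mul_sum, Finset.sum_div, ← Finset.sum_add_distrib,
    ← Finset.sum_sub_distrib]
  refine Finset.sum_le_sum fun i _ => Finset.sum_le_sum fun j _ => ?_
  simp only [Matrix.map_apply, Matrix.add_apply, Matrix.smul_apply, Matrix.sub_apply, smul_eq_mul]
  set c := β₁ * M i j + (1 - β₁) * g i j with hc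
  have h := half_abs_sub_le_mul_sign ((1 - β₁) * A i j) c
  have h1 : |(1 - β₁) * A i j - c| ≤ β₁ * |M i j| + (1 - β₁) * |g i j - A i j| := by
    rw [show (1 - β₁) * A i j - c = -(β₁ * M i j + (1 - β₁) * (g i j - A i j)) by rw [hc]; ring,
      abs_neg]
    refine (abs_add_le _ _).trans_eq ?_
    rw [abs_mul, abs_mul, abs_of_nonneg hβ₁, abs_of_pos (sub_pos.2 hβ₁')]
  rw [abs_mul, abs_of_pos (sub_pos.2 hβ₁')] at h
  linarith

/-- Descent in one sign step. The momentum enters with the factor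
`3 / 2 * (β₁ * √(m * n) / (1 - β₁)) ≤ 2 / 5`. -/
lemma LSmooth.sign_step_le {f : Matrix (Fin m) (Fin n) ℝ → ℝ} {L : ℝ} (hf : LSmooth f L)
    (hL : 0 ≤ L) (W M g : Matrix (Fin m) (Fin n) ℝ) {β₁ α : ℝ} (hα : 0 ≤ α) (hβ₁ : 0 ≤ β₁)
    (hδ : 4 ≤ √((m : ℝ) * n)) (hβδ : β₁ * √((m : ℝ) * n) ≤ 1 / 4) :
    f (W - α • (β₁ • M + (1 - β₁) • g).map Real.sign) ≤ f W - α * (l1Norm (grad f W) / 2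
      - 2 / 5 * ‖M‖ - 3 / 2 * √((m : ℝ) * n) * ‖g - grad f W‖) + L * α ^ 2 * ((m : ℝ) * n) := by
  set δ := √((m : ℝ) * n) with hδdef
  have hδ2 : δ ^ 2 = (m : ℝ) * n := Real.sq_sqrt (by positivity)
  set S := (β₁ • M + (1 - β₁) • g).map Real.sign with hS
  have hβ : β₁ ≤ 1 / 16 := by nlinarith
  have h1 := hf.apply_add_le hL W (-(α • S))
  rw [← sub_eq_add_neg, norm_neg, norm_smul, Real.norm_of_nonneg hα, mul_pow] at h1
  have h2 : ∑ i, ∑ j, grad f W i j * (-(α • S)) i j = -(α * ∑ i, ∑ j, grad f W i j * S i j) := by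
    simp only [Matrix.neg_apply, Matrix.smul_apply, smul_eq_mul, Finset.mul_sum,
      ← Finset.sum_neg_distrib]
    exact Finset.sum_congr rfl fun i _ => Finset.sum_congr rfl fun j _ => by ring
  have h3 : ‖S‖ ^ 2 ≤ (m : ℝ) * n := by
    rw [← hδ2]
    exact pow_le_pow_left₀ (norm_nonneg _) (norm_map_sign_le _) 2
  have h4 := sum_mul_sign_ge (grad f W) M g hβ₁ (by linarith : β₁ < 1)
  have h5 : β₁ * l1Norm M ≤ (1 - β₁) * (4 / 15 * ‖M‖) := by
    calc β₁ * l1Norm M ≤ β₁ * (δ * ‖M‖) :=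
          mul_le_mul_of_nonneg_left (l1Norm_le_sqrt_mul_norm M) hβ₁
      _ = β₁ * δ * ‖M‖ := by ring
      _ ≤ (1 - β₁) * (4 / 15) * ‖M‖ :=
          mul_le_mul_of_nonneg_right (by linarith) (norm_nonneg M)
      _ = _ := by ring
  have h6 := l1Norm_le_sqrt_mul_norm (g - grad f W)
  have h7 : l1Norm (grad f W) / 2 - 2 / 5 * ‖M‖ - 3 / 2 * δ * ‖g - grad f W‖ ≤
      ∑ i, ∑ j, grad f W i j * S i j := by
    refine le_of_mul_le_mul_left (a := 1 - β₁) ?_ (by linarith)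
    have := mul_le_mul_of_nonneg_left h6 (by linarith : 0 ≤ 1 - β₁)
    linarith
  have h8 := mul_le_mul_of_nonneg_left h7 hα
  have h9 := mul_le_mul_of_nonneg_left h3 (by positivity : 0 ≤ L * α ^ 2)
  linarith

/-! ### Summation along a trajectory -/

/-- An exponential moving average started at zero has total at most that of its inputs. -/
lemma sum_le_sum_of_moving_average {M N : ℕ → ℝ} {β : ℝ} (hβ : β < 1) (h0 : M 0 = 0)
    (hM : ∀ t, 0 ≤ M t) (hrec : ∀ t, M (t + 1) ≤ β * M t + (1 - β) * N t) (T : ℕ) :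
    ∑ t ∈ Finset.range T, M t ≤ ∑ t ∈ Finset.range T, N t := by
  have h : (1 - β) * ∑ t ∈ Finset.range T, M t + M T ≤
      (1 - β) * ∑ t ∈ Finset.range T, N t := by
    induction T with
    | zero => simp [h0]
    | succ T ih =>
      rw [Finset.sum_range_succ, Finset.sum_range_succ]
      linarith [hrec T]
  exact le_of_mul_le_mul_left (by linarith [hM T]) (sub_pos.2 hβ)

section Trajectory

variable {Ξ : Type*} (qr : QRRoutine m l) (svd : SVDRoutine l n) (hk : k ≤ l)
  (G : Matrix (Fin m) (Fin n) ℝ → Ξ → Matrix (Fin m) (Fin n) ℝ) (β₁ β₂ α : ℝ)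
  (W₁ : Matrix (Fin m) (Fin n) ℝ) (x : ℕ → Fin b → Ξ) (Om : ℕ → Matrix (Fin n) (Fin l) ℝ)

lemma abs_state_sub_le (hα : 0 ≤ α) (t : ℕ) (i : Fin m) (j : Fin n) :
    |(state qr svd hk G β₁ β₂ α W₁ x Om t).W i j - W₁ i j| ≤ t * α := by
  induction t with
  | zero => simp [state]
  | succ t ih =>
    simp only [state, step, Matrix.sub_apply, Matrix.smul_apply, Matrix.map_apply, smul_eq_mul]
    rw [sub_right_comm]
    refine (abs_sub _ _).trans ?_
    have h : ∀ c : ℝ, |α * Real.sign c| ≤ α := fun c => by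
      rcases Real.sign_apply_eq c with h | h | h <;> simp [h, abs_of_nonneg hα, hα]
    push_cast
    linarith [h ((β₁ • (state qr svd hk G β₁ β₂ α W₁ x Om t).mom.reconstruct + (1 - β₁) •
      batchGrad G (state qr svd hk G β₁ β₂ α W₁ x Om t).W (x t)) i j)]

lemma norm_momentum_succ_le (f : Matrix (Fin m) (Fin n) ℝ → ℝ) (hβ₂ : 0 ≤ β₂) (hβ₂' : β₂ < 1)
    (t : ℕ) :
    ‖(state qr svd hk G β₁ β₂ α W₁ x Om (t + 1)).mom.reconstruct‖ ≤
      β₂ * ‖(state qr svd hk G β₁ β₂ α W₁ x Om t).mom.reconstruct‖ + (1 - β₂) *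
        (l1Norm (grad f (state qr svd hk G β₁ β₂ α W₁ x Om t).W)
        + ‖batchGrad G (state qr svd hk G β₁ β₂ α W₁ x Om t).W (x t)
          - grad f (state qr svd hk G β₁ β₂ α W₁ x Om t).W‖) := by
  set S := state qr svd hk G β₁ β₂ α W₁ x Om t with hS
  refine (norm_rsvd_reconstruct_le qr svd hk
    (β₂ • S.mom.reconstruct + (1 - β₂) • batchGrad G S.W (x t)) (Om t)).trans ?_
  refine (norm_add_le _ _).trans ?_
  rw [norm_smul, norm_smul, Real.norm_of_nonneg hβ₂, Real.norm_of_nonneg (by linarith)]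
  have h1 : ‖batchGrad G S.W (x t)‖ ≤
      l1Norm (grad f S.W) + ‖batchGrad G S.W (x t) - grad f S.W‖ :=
    (norm_le_insert' _ (grad f S.W)).trans (by gcongr; exact norm_le_l1Norm _)
  have := mul_le_mul_of_nonneg_left h1 (by linarith : 0 ≤ 1 - β₂)
  linarith

/-- The descent inequality summed along a trajectory, for every realization of the randomness.
The momentum terms cost `2 / 5` of the `1 / 2` in front of the gradient terms, which leaves
`1 / 10`, and raise the factor of the mini-batch errors from `3 / 2` to `8 / 5`. -/
lemma LSmooth.sum_l1Norm_grad_le {f : Matrix (Fin m) (Fin n) ℝ → ℝ} {L : ℝ} (hf : LSmooth f L)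
    (hL : 0 ≤ L) (hα : 0 ≤ α) (hβ₁ : 0 ≤ β₁) (hδ : 4 ≤ √((m : ℝ) * n))
    (hβδ : β₁ * √((m : ℝ) * n) ≤ 1 / 4) (hβ₂ : 0 ≤ β₂) (hβ₂' : β₂ < 1) (T : ℕ) :
    α * ∑ t ∈ Finset.range T, l1Norm (grad f (state qr svd hk G β₁ β₂ α W₁ x Om t).W) ≤
      10 * (f W₁ - f (state qr svd hk G β₁ β₂ α W₁ x Om T).W
        + 8 / 5 * √((m : ℝ) * n) * α * ∑ t ∈ Finset.range T,
          ‖batchGrad G (state qr svd hk G β₁ β₂ α W₁ x Om t).W (x t)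
            - grad f (state qr svd hk G β₁ β₂ α W₁ x Om t).W‖
        + T * (L * α ^ 2 * ((m : ℝ) * n))) := by
  set S := state qr svd hk G β₁ β₂ α W₁ x Om with hS
  set e := fun t => ‖batchGrad G (S t).W (x t) - grad f (S t).W‖ with he
  have h1 : ∀ t, f (S (t + 1)).W ≤ f (S t).W - α * (l1Norm (grad f (S t).W) / 2
      - 2 / 5 * ‖(S t).mom.reconstruct‖ - 3 / 2 * √((m : ℝ) * n) * e t)
      + L * α ^ 2 * ((m : ℝ) * n) := fun t =>
    hf.sign_step_le hL (S t).W (S t).mom.reconstruct (batchGrad G (S t).W (x t)) hα hβ₁ hδ hβδ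
  have h2 : α * (1 / 2 * ∑ t ∈ Finset.range T, l1Norm (grad f (S t).W)
      - 2 / 5 * ∑ t ∈ Finset.range T, ‖(S t).mom.reconstruct‖
      - 3 / 2 * √((m : ℝ) * n) * ∑ t ∈ Finset.range T, e t) ≤
      f W₁ - f (S T).W + T * (L * α ^ 2 * ((m : ℝ) * n)) := by
    have h := Finset.sum_range_sub (fun t => f (S t).W) T
    have h0 : (S 0).W = W₁ := rfl
    rw [h0] at h
    simp only [Finset.mul_sum, ← Finset.sum_sub_distrib]
    have h4 : (T : ℝ) * (L * α ^ 2 * ((m : ℝ) * n)) =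
        ∑ t ∈ Finset.range T, L * α ^ 2 * ((m : ℝ) * n) := by simp
    rw [h4, ← neg_sub, ← h, ← Finset.sum_neg_distrib, ← Finset.sum_add_distrib]
    refine Finset.sum_le_sum fun t _ => ?_
    linarith [h1 t]
  have h3 := sum_le_sum_of_moving_average (M := fun t => ‖(S t).mom.reconstruct‖)
    (N := fun t => l1Norm (grad f (S t).W) + e t) hβ₂' (by simp [hS, state, Factors.reconstruct])
    (fun t => norm_nonneg _)
    (fun t => norm_momentum_succ_le qr svd hk G β₁ β₂ α W₁ x Om f hβ₂ hβ₂' t) T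
  rw [Finset.sum_add_distrib] at h3
  have he0 : 0 ≤ ∑ t ∈ Finset.range T, e t := Finset.sum_nonneg fun t _ => norm_nonneg _
  have h4 : 2 / 5 * ∑ t ∈ Finset.range T, e t ≤
      1 / 10 * √((m : ℝ) * n) * ∑ t ∈ Finset.range T, e t :=
    mul_le_mul_of_nonneg_right (by linarith) he0
  have h5 : 1 / 10 * ∑ t ∈ Finset.range T, l1Norm (grad f (S t).W)
      - 8 / 5 * √((m : ℝ) * n) * ∑ t ∈ Finset.range T, e t ≤
      1 / 2 * ∑ t ∈ Finset.range T, l1Norm (grad f (S t).W)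
      - 2 / 5 * ∑ t ∈ Finset.range T, ‖(S t).mom.reconstruct‖
      - 3 / 2 * √((m : ℝ) * n) * ∑ t ∈ Finset.range T, e t := by linarith
  have h6 := mul_le_mul_of_nonneg_left h5 hα
  linarith

end Trajectory

/-! ### Expectations -/

/-- A continuous function of a random matrix with bounded entries is integrable. -/
lemma integrable_comp_of_abs_sub_le {Ω : Type*} [MeasurableSpace Ω] {P : Measure Ω}
    [IsFiniteMeasure P] {h : Matrix (Fin m) (Fin n) ℝ → ℝ} (hh : Continuous h)
    {X : Ω → Matrix (Fin m) (Fin n) ℝ} (hX : Measurable X) (W₁ : Matrix (Fin m) (Fin n) ℝ) (R : ℝ)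
    (hb : ∀ ω i j, |X ω i j - W₁ i j| ≤ R) : Integrable (fun ω => h (X ω)) P := by
  have hK : IsCompact (Set.univ.pi fun i => Set.univ.pi fun j =>
      Set.Icc (W₁ i j - R) (W₁ i j + R) : Set (Fin m → Fin n → ℝ)) :=
    isCompact_univ_pi fun i => isCompact_univ_pi fun j => isCompact_Icc
  obtain ⟨c, hc⟩ := hK.exists_bound_of_continuousOn (f := h) hh.continuousOn
  refine (integrable_const c).mono' (hh.measurable.comp hX).aestronglyMeasurable
    (Filter.Eventually.of_forall fun ω => hc _ fun i _ j _ => ?_)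
  obtain ⟨h1, h2⟩ := abs_le.1 (hb ω i j)
  exact ⟨by linarith, by linarith⟩

lemma continuous_l1Norm : Continuous (l1Norm : Matrix (Fin m) (Fin n) ℝ → ℝ) :=
  continuous_finsetSum _ fun i _ => continuous_finsetSum _ fun j _ =>
    (continuous_id.matrix_elem i j).abs

section Expectation

variable {Ω Ξ : Type*} [MeasurableSpace Ω] [MeasurableSpace Ξ] {P : Measure Ω} {D : Measure Ξ}
  {f : Matrix (Fin m) (Fin n) ℝ → ℝ}
  {G : Matrix (Fin m) (Fin n) ℝ → Ξ → Matrix (Fin m) (Fin n) ℝ}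
  {L σ β₁ β₂ α : ℝ} {ξ : ℕ → Fin b → Ω → Ξ} {Om : ℕ → Ω → Matrix (Fin n) (Fin l) ℝ}

lemma measurable_weights (hG : IsStochasticGradient f G D σ) (hs : IsSampling P D ξ Om)
    (qr : QRRoutine m l) (svd : SVDRoutine l n) (hk : k ≤ l) (W₁ : Matrix (Fin m) (Fin n) ℝ)
    (t : ℕ) : Measurable fun ω =>
      weights qr svd hk G β₁ β₂ α W₁ (fun s i => ξ s i ω) (fun s => Om s ω) t :=
  (measurable_state qr svd hk hG.measurable β₁ β₂ α W₁ (t - 1)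
    (fun s _ => hs.measurable_sample s) fun s _ => hs.measurable_test s).1

lemma integrable_comp_weights [IsFiniteMeasure P] (hG : IsStochasticGradient f G D σ) (hs : IsSampling P D ξ Om)
    (qr : QRRoutine m l) (svd : SVDRoutine l n) (hk : k ≤ l) (W₁ : Matrix (Fin m) (Fin n) ℝ)
    (hα : 0 ≤ α) {h : Matrix (Fin m) (Fin n) ℝ → ℝ} (hh : Continuous h) (t : ℕ) :
    Integrable (fun ω =>
      h (weights qr svd hk G β₁ β₂ α W₁ (fun s i => ξ s i ω) (fun s => Om s ω) t)) P :=
  integrable_comp_of_abs_sub_le hh (measurable_weights hG hs qr svd hk W₁ t) W₁ _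
    fun _ i j => abs_state_sub_le qr svd hk G β₁ β₂ α W₁ _ _ hα (t - 1) i j

/-- The bound behind all three parts, with absolute constants; `α = 0` is allowed. -/
lemma mul_avgGrad_le [IsProbabilityMeasure P] [IsProbabilityMeasure D] (hf : LSmooth f L) (hL : 0 ≤ L) (hσ : 0 ≤ σ) (hb : 1 ≤ b)
    (hG : IsStochasticGradient f G D σ) (hs : IsSampling P D ξ Om)
    (qr : QRRoutine m l) (svd : SVDRoutine l n) (hk : k ≤ l) (W₁ : Matrix (Fin m) (Fin n) ℝ)
    (hα : 0 ≤ α) (hβ₁ : 0 ≤ β₁) (hδ : 4 ≤ √((m : ℝ) * n))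
    (hβδ : β₁ * √((m : ℝ) * n) ≤ 1 / 4) (hβ₂ : 0 ≤ β₂) (hβ₂' : β₂ < 1) {T : ℕ} (hT : 1 ≤ T) :
    α * avgGrad P f (fun t ω => weights qr svd hk G β₁ β₂ α W₁ (fun s i => ξ s i ω)
        (fun s => Om s ω) t) T ≤
      10 * ((f W₁ - ∫ ω, f (weights qr svd hk G β₁ β₂ α W₁ (fun s i => ξ s i ω)
        (fun s => Om s ω) (T + 1)) ∂P) / T
        + 8 / 5 * α * (σ * √((m : ℝ) * n) / √(b : ℝ)) + L * α ^ 2 * ((m : ℝ) * n)) := by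
  set S := fun ω => state qr svd hk G β₁ β₂ α W₁ (fun s i => ξ s i ω) (fun s => Om s ω) with hS
  have hgrad : Continuous fun w => l1Norm (grad f w) := continuous_l1Norm.comp hf.continuous_grad
  have hfc : Continuous f := hf.differentiable.continuous
  have hn : ∀ t, Integrable (fun ω => l1Norm (grad f (S ω t).W)) P := fun t =>
    integrable_comp_weights hG hs qr svd hk W₁ hα hgrad (t + 1)
  have hfT : Integrable (fun ω => f (S ω T).W) P :=
    integrable_comp_weights hG hs qr svd hk W₁ hα hfc (T + 1)
  have he : ∀ t, Integrable (fun ω => ‖batchGrad G (S ω t).W (fun i => ξ t i ω)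
        - grad f (S ω t).W‖) P ∧
      ∫ ω, ‖batchGrad G (S ω t).W (fun i => ξ t i ω) - grad f (S ω t).W‖ ∂P ≤ σ / √(b : ℝ) :=
    fun t => hG.integral_norm_error_le hf.continuous_grad.measurable hσ hb
      (measurable_weights hG hs qr svd hk W₁ (t + 1))
      (measurable_pi_iff.2 (hs.measurable_sample t)) (hs.map_batch t)
      (hs.indepFun_state_batch qr svd hk hG.measurable β₁ β₂ α W₁ t)
  have hT0 : (0 : ℝ) < T := by exact_mod_cast hT
  have hmain : α * ∑ t ∈ Finset.range T, ∫ ω, l1Norm (grad f (S ω t).W) ∂P ≤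
      10 * (f W₁ - ∫ ω, f (S ω T).W ∂P + 8 / 5 * √((m : ℝ) * n) * α * (T * (σ / √(b : ℝ)))
        + T * (L * α ^ 2 * ((m : ℝ) * n))) := by
    have hsum := integrable_finsetSum (Finset.range T) fun t _ => (he t).1
    have h1 : Integrable (fun ω => f W₁ - f (S ω T).W) P := (integrable_const _).sub hfT
    have h2 : Integrable (fun ω => 8 / 5 * √((m : ℝ) * n) * α * ∑ t ∈ Finset.range T,
        ‖batchGrad G (S ω t).W (fun i => ξ t i ω) - grad f (S ω t).W‖) P := hsum.const_mul _
    have h := integral_mono (μ := P)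
      ((integrable_finsetSum (Finset.range T) fun t _ => hn t).const_mul α)
      (((h1.add h2).add (integrable_const _)).const_mul 10)
      fun ω => hf.sum_l1Norm_grad_le qr svd hk G β₁ β₂ α W₁ (fun s i => ξ s i ω)
        (fun s => Om s ω) hL hα hβ₁ hδ hβδ hβ₂ hβ₂' T
    rw [integral_const_mul, integral_finsetSum _ fun t _ => hn t, integral_const_mul,
      integral_add' (h1.add h2) (integrable_const _), integral_add' h1 h2,
      integral_sub (integrable_const _) hfT, integral_const_mul,
      integral_finsetSum _ fun t _ => (he t).1] at h
    simp only [integral_const, probReal_univ, one_smul] at h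
    refine h.trans ?_
    have h3 : ∑ t ∈ Finset.range T, ∫ ω, ‖batchGrad G (S ω t).W (fun i => ξ t i ω)
        - grad f (S ω t).W‖ ∂P ≤ T * (σ / √(b : ℝ)) := by
      simpa using Finset.sum_le_sum fun t (_ : t ∈ Finset.range T) => (he t).2
    gcongr
  have havg : avgGrad P f (fun t ω => weights qr svd hk G β₁ β₂ α W₁ (fun s i => ξ s i ω)
      (fun s => Om s ω) t) T =
      (1 / (T : ℝ)) * ∑ t ∈ Finset.range T, ∫ ω, l1Norm (grad f (S ω t).W) ∂P := by
    rw [avgGrad, show Finset.Icc 1 T = Finset.Ico 1 (T + 1) by ext; simp,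
      Finset.sum_Ico_eq_sum_range]
    simp only [weights, Nat.add_sub_cancel_left, Nat.add_sub_cancel, hS]
  rw [havg]
  calc α * ((1 / (T : ℝ)) * ∑ t ∈ Finset.range T, ∫ ω, l1Norm (grad f (S ω t).W) ∂P)
      = (1 / (T : ℝ)) * (α * ∑ t ∈ Finset.range T, ∫ ω, l1Norm (grad f (S ω t).W) ∂P) := by ring
    _ ≤ (1 / (T : ℝ)) * _ := mul_le_mul_of_nonneg_left hmain (by positivity)
    _ = _ := by
        simp only [weights, Nat.add_sub_cancel, hS]
        field_simp

end Expectation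

/-! ### Constants of the theorem -/

lemma one_le_gam (r : ℕ) {p : ℕ} (hp : 2 ≤ p) : 1 ≤ gam r p := by
  have h : (2 : ℝ) ≤ p := by exact_mod_cast hp
  have h1 : 0 ≤ (r : ℝ) / ((p : ℝ) - 1) := div_nonneg (by positivity) (by linarith)
  exact Real.one_le_sqrt.2 (by linarith)

lemma four_le_sqrt_mul {m n : ℕ} (h : 4 ≤ min m n) : 4 ≤ √((m : ℝ) * n) := by
  have hm : (4 : ℝ) ≤ m := by exact_mod_cast h.trans (min_le_left _ _)
  have hn : (4 : ℝ) ≤ n := by exact_mod_cast h.trans (min_le_right _ _)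
  exact Real.le_sqrt_of_sq_le (by nlinarith)

lemma mul_le_quarter_of_le {γ δ β₁ : ℝ} (hγ : 1 ≤ γ) (hδ : 0 < δ) (hβ : β₁ ≤ 1 / (4 * γ * δ)) :
    β₁ * δ ≤ 1 / 4 := by
  rw [le_div_iff₀ (by positivity)] at hβ
  by_contra! h
  nlinarith

/-- The two terms with `γ` and `|β₁ - β₂| + 1 - β₁` dominate `(1 + 15 / 16) s ≥ (8 / 5) s`:
whichever of `β₁ ≤ 1 / 16` and `β₂` is larger, `|β₁ - β₂| + 1 - β₁ ≥ 15 / 16`. -/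
lemma noise_terms_ge {γ δ β₁ β₂ s : ℝ} (hγ : 1 ≤ γ) (hδ : 4 ≤ δ) (hβ₁ : 0 ≤ β₁)
    (hβδ : β₁ * δ ≤ 1 / 4) (hβ₂ : 0 ≤ β₂) (hβ₂' : β₂ < 1) (hs : 0 ≤ s) :
    8 / 5 * s ≤ γ * s + (|β₁ - β₂| + 1 - β₁) * (s / √(1 - β₂)) := by
  have hβ : β₁ ≤ 1 / 16 := by nlinarith
  have h1 : 15 / 16 ≤ |β₁ - β₂| + 1 - β₁ := by cases abs_cases (β₁ - β₂) <;> linarith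
  have h2 : s ≤ s / √(1 - β₂) :=
    le_div_self hs (Real.sqrt_pos.2 (by linarith)) (Real.sqrt_le_one.2 (by linarith))
  have h3 := mul_le_mul h1 h2 hs (by linarith)
  nlinarith

/-- With the step size `√(Δ / (L d T))` the two terms it balances are equal. -/
lemma step_size_balance {Δ L d T : ℝ} (hΔ : 0 < Δ) (hL : 0 < L) (hd : 0 < d) (hT : 0 < T) :
    Δ / T = √(Δ / (L * d * T)) * (√(d * L * Δ) / √T) ∧
    L * √(Δ / (L * d * T)) ^ 2 * d = √(Δ / (L * d * T)) * (√(d * L * Δ) / √T) := by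
  have h : √(Δ / (L * d * T)) * (√(d * L * Δ) / √T) = Δ / T := by
    rw [← Real.sqrt_div (by positivity), ← Real.sqrt_mul (by positivity),
      show Δ / (L * d * T) * (d * L * Δ / T) = (Δ / T) ^ 2 by field_simp]
    exact Real.sqrt_sq (by positivity)
  refine ⟨h.symm, ?_⟩
  rw [h, Real.sq_sqrt (by positivity)]
  field_simp

/-- Rounding `1600 q / ε²` up to `N` makes `√q / √N` at most `ε / 40` and costs at most a
factor `2`. -/
lemma ceil_complexity {q ε : ℝ} (hε : 0 < ε) (hq : ε ^ 2 ≤ q) {N : ℕ}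
    (hN : N = ⌈1600 * (q / ε ^ 2)⌉₊) :
    √q / √(N : ℝ) ≤ ε / 40 ∧ (N : ℝ) ≤ 2 * 1600 * (q / ε ^ 2) := by
  have hx : 1 ≤ q / ε ^ 2 := (one_le_div (by positivity)).2 hq
  have h1 : 1600 * (q / ε ^ 2) ≤ N := hN ▸ Nat.le_ceil _
  have h2 : (N : ℝ) < 1600 * (q / ε ^ 2) + 1 := hN ▸ Nat.ceil_lt_add_one (by positivity)
  have hN0 : (0 : ℝ) < N := by linarith
  refine ⟨?_, by linarith⟩
  rw [← Real.sqrt_div' _ hN0.le, Real.sqrt_le_left (by positivity), div_le_iff₀ hN0]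
  have h3 : q / ε ^ 2 * ε ^ 2 = q := div_mul_cancel₀ _ (by positivity)
  nlinarith [sq_nonneg ε]

section Bounds

variable {Ω Ξ : Type*} [MeasurableSpace Ω] [MeasurableSpace Ξ] {P : Measure Ω}
  [IsProbabilityMeasure P] {D : Measure Ξ} [IsProbabilityMeasure D]
  {f : Matrix (Fin m) (Fin n) ℝ → ℝ}
  {G : Matrix (Fin m) (Fin n) ℝ → Ξ → Matrix (Fin m) (Fin n) ℝ}
  {L σ β₁ β₂ : ℝ} {ξ : ℕ → Fin b → Ω → Ξ} {Om : ℕ → Ω → Matrix (Fin n) (Fin l) ℝ}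

/-- The bound for the step size `√(Δ / (L d T))`. When `Δ = 0` the step size vanishes, the weights
stay at the minimizer `W₁`, and the gradients are zero. -/
lemma avgGrad_le_of_bddBelow (hf : LSmooth f L) (hL : 0 < L) (hσ : 0 ≤ σ) (hb : 1 ≤ b)
    (hG : IsStochasticGradient f G D σ) (hs : IsSampling P D ξ Om)
    (qr : QRRoutine m l) (svd : SVDRoutine l n) (hk : k ≤ l) (W₁ : Matrix (Fin m) (Fin n) ℝ)
    (hβ₁ : 0 ≤ β₁) (hδ : 4 ≤ √((m : ℝ) * n)) (hβδ : β₁ * √((m : ℝ) * n) ≤ 1 / 4)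
    (hβ₂ : 0 ≤ β₂) (hβ₂' : β₂ < 1) {T : ℕ} (hT : 1 ≤ T) (hbdd : BddBelow (Set.range f)) {Δ : ℝ}
    (hΔ : Δ = f W₁ - ⨅ V, f V) :
    avgGrad P f (fun t ω => weights qr svd hk G β₁ β₂ (√(Δ / (L * ((m : ℝ) * n) * T))) W₁
        (fun s i => ξ s i ω) (fun s => Om s ω) t) T ≤
      20 * (√((m : ℝ) * n * L * Δ) / √(T : ℝ) + σ * √((m : ℝ) * n) / √(b : ℝ)) := by
  have hT0 : (0 : ℝ) < T := by exact_mod_cast hT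
  have hd : (0 : ℝ) < (m : ℝ) * n := Real.sqrt_pos.1 (by linarith)
  have hΔ0 : 0 ≤ Δ := by linarith [ciInf_le hbdd W₁]
  set α := √(Δ / (L * ((m : ℝ) * n) * T)) with hαdef
  rcases hΔ0.eq_or_lt with h0 | hpos
  · have hα0 : α = 0 := by rw [hαdef, ← h0, zero_div, Real.sqrt_zero]
    have hmin : grad f W₁ = 0 := grad_eq_zero_of_forall_le fun V => by
      linarith [ciInf_le hbdd V]
    have hW : ∀ t ω, weights qr svd hk G β₁ β₂ α W₁ (fun s i => ξ s i ω)
        (fun s => Om s ω) t = W₁ := fun t ω => by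
      ext i j
      have := abs_state_sub_le qr svd hk G β₁ β₂ α W₁ (fun s i => ξ s i ω)
        (fun s => Om s ω) hα0.ge (t - 1) i j
      rw [hα0, mul_zero] at this
      rw [weights, hα0]
      exact sub_eq_zero.1 (abs_nonpos_iff.1 this)
    simp only [avgGrad, hW, hmin]
    simp only [l1Norm, Matrix.zero_apply, abs_zero, Finset.sum_const_zero, integral_zero, mul_zero]
    positivity
  · have hα : 0 < α := Real.sqrt_pos.2 (by positivity)
    have h := mul_avgGrad_le hf hL.le hσ hb hG hs qr svd hk W₁ hα.le hβ₁ hδ hβδ hβ₂ hβ₂' hT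
    set S := σ * √((m : ℝ) * n) / √(b : ℝ) with hS
    have hS0 : 0 ≤ S := by positivity
    obtain ⟨h1, h2⟩ := step_size_balance hpos hL hd hT0
    rw [← hαdef] at h1 h2
    set A := √((m : ℝ) * n * L * Δ) / √(T : ℝ) with hA
    have hfc : Continuous f := hf.differentiable.continuous
    have h3 : ⨅ V, f V ≤ ∫ ω, f (weights qr svd hk G β₁ β₂ α W₁ (fun s i => ξ s i ω)
        (fun s => Om s ω) (T + 1)) ∂P := by
      have := integral_mono (μ := P) (integrable_const (⨅ V, f V))
        (integrable_comp_weights (β₁ := β₁) (β₂ := β₂) hG hs qr svd hk W₁ hα.le hfc (T + 1))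
        fun ω => ciInf_le hbdd _
      simpa using this
    have h4 : (f W₁ - ∫ ω, f (weights qr svd hk G β₁ β₂ α W₁ (fun s i => ξ s i ω)
        (fun s => Om s ω) (T + 1)) ∂P) / T ≤ Δ / T :=
      div_le_div_of_nonneg_right (by linarith) hT0.le
    refine le_of_mul_le_mul_left (a := α) ?_ hα
    nlinarith [mul_nonneg hα.le hS0]

end Bounds

end MLorc

theorem theorem1 :
    -- general step size
    (∃ C : ℝ, 0 < C ∧
      ∀ (m n r p k b T : ℕ) (_ : 2 ≤ r) (_ : 2 ≤ p) (_ : r + p ≤ min m n)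
        (_ : r ≤ k) (hk : k ≤ r + p) (_ : 1 ≤ b) (_ : 1 ≤ T)
        (Ω Ξ : Type*) [MeasurableSpace Ω] [MeasurableSpace Ξ]
        (P : Measure Ω) [IsProbabilityMeasure P] (D : Measure Ξ) [IsProbabilityMeasure D]
        (f : Matrix (Fin m) (Fin n) ℝ → ℝ)
        (G : Matrix (Fin m) (Fin n) ℝ → Ξ → Matrix (Fin m) (Fin n) ℝ)
        (L σ β₁ β₂ α : ℝ) (W₁ : Matrix (Fin m) (Fin n) ℝ)
        (qr : MLorc.QRRoutine m (r + p)) (svd : MLorc.SVDRoutine (r + p) n)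
        (ξ : ℕ → Fin b → Ω → Ξ) (Om : ℕ → Ω → Matrix (Fin n) (Fin (r + p)) ℝ)
        (W : ℕ → Ω → Matrix (Fin m) (Fin n) ℝ),
        MLorc.LSmooth f L → 0 ≤ σ → MLorc.IsStochasticGradient f G D σ →
        MLorc.IsSampling P D ξ Om →
        0 ≤ β₁ → β₁ ≤ 1 / (4 * MLorc.gam r p * √((m : ℝ) * n)) →
        0 ≤ β₂ → β₂ < 1 → 0 < α →
        (∀ t ω, W t ω = MLorc.weights qr svd hk G β₁ β₂ α W₁
          (fun s i => ξ s i ω) (fun s => Om s ω) t) →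
        (∀ t, Integrable (fun ω => MLorc.l1Norm (MLorc.grad f (W t ω))) P) ∧
        Integrable (fun ω => f (W (T + 1) ω)) P ∧
        MLorc.avgGrad P f W T ≤
          C * ((f W₁ - ∫ ω, f (W (T + 1) ω) ∂P) / (α * T)
            + σ * √((m : ℝ) * n) / (√(b : ℝ) * T * (1 - β₂))
            + 2 * L * α * β₁ * ((m : ℝ) * n) / (1 - β₂)
            + ((m : ℝ) * n) * L * α
            + MLorc.gam r p * (σ * √((m : ℝ) * n) / √(b : ℝ))
            + (|β₁ - β₂| + 1 - β₁) * (√((m : ℝ) * n) * σ / √((b : ℝ) * (1 - β₂))))) ∧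
    -- step size `√(Δ / (L d T))`, with `γ` bounded and `β₂` bounded away from one
    (∀ Γ β : ℝ, β < 1 → ∃ C : ℝ, 1 ≤ C ∧
      ∀ (m n r p k b T : ℕ) (_ : 2 ≤ r) (_ : 2 ≤ p) (_ : r + p ≤ min m n)
        (_ : r ≤ k) (hk : k ≤ r + p) (_ : 1 ≤ b) (_ : 1 ≤ T)
        (Ω Ξ : Type*) [MeasurableSpace Ω] [MeasurableSpace Ξ]
        (P : Measure Ω) [IsProbabilityMeasure P] (D : Measure Ξ) [IsProbabilityMeasure D]
        (f : Matrix (Fin m) (Fin n) ℝ → ℝ)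
        (G : Matrix (Fin m) (Fin n) ℝ → Ξ → Matrix (Fin m) (Fin n) ℝ)
        (L σ β₁ β₂ Δ : ℝ) (W₁ : Matrix (Fin m) (Fin n) ℝ)
        (qr : MLorc.QRRoutine m (r + p)) (svd : MLorc.SVDRoutine (r + p) n)
        (ξ : ℕ → Fin b → Ω → Ξ) (Om : ℕ → Ω → Matrix (Fin n) (Fin (r + p)) ℝ)
        (W : ℕ → Ω → Matrix (Fin m) (Fin n) ℝ),
        MLorc.LSmooth f L → 0 < L → 0 ≤ σ → MLorc.IsStochasticGradient f G D σ →
        MLorc.IsSampling P D ξ Om →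
        BddBelow (Set.range f) → Δ = f W₁ - ⨅ V, f V →
        MLorc.gam r p ≤ Γ →
        0 ≤ β₁ → β₁ ≤ 1 / (4 * MLorc.gam r p * √((m : ℝ) * n)) →
        0 ≤ β₂ → β₂ ≤ β →
        (∀ t ω, W t ω = MLorc.weights qr svd hk G β₁ β₂ (√(Δ / (L * ((m : ℝ) * n) * T))) W₁
          (fun s i => ξ s i ω) (fun s => Om s ω) t) →
        (∀ t, Integrable (fun ω => MLorc.l1Norm (MLorc.grad f (W t ω))) P) ∧
        MLorc.avgGrad P f W T ≤
          C * (√((m : ℝ) * n * L * Δ) / √(T : ℝ) + σ * √((m : ℝ) * n) / √(b : ℝ)) ∧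
        -- iteration complexity in the deterministic case
        (∀ ε : ℝ, 0 < ε → ε ^ 2 ≤ Δ * L * ((m : ℝ) * n) → σ = 0 →
          T = ⌈C * (Δ * L * ((m : ℝ) * n) / ε ^ 2)⌉₊ →
          MLorc.avgGrad P f W T ≤ ε ∧
          (T : ℝ) ≤ 2 * C * (Δ * L * ((m : ℝ) * n) / ε ^ 2)) ∧
        -- sample complexity in the stochastic case
        (∀ ε : ℝ, 0 < ε → ε ^ 2 ≤ Δ * L * ((m : ℝ) * n) → ε ^ 2 ≤ (m : ℝ) * n * σ ^ 2 →
          T = ⌈C * (Δ * L * ((m : ℝ) * n) / ε ^ 2)⌉₊ →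
          b = ⌈C * ((m : ℝ) * n * σ ^ 2 / ε ^ 2)⌉₊ →
          MLorc.avgGrad P f W T ≤ ε ∧
          (b : ℝ) * T ≤ 4 * C ^ 2 * (Δ * L * ((m : ℝ) * n) ^ 2 * σ ^ 2 / ε ^ 4))) := by
  refine ⟨⟨10, by norm_num, ?_⟩, fun Γ β hβ => ⟨1600, by norm_num, ?_⟩⟩
  · intro m n r p k b T hr hp hrp _ hk hb hT Ω Ξ _ _ P _ D _ f G L σ β₁ β₂ α W₁ qr svd ξ Om W
      hf hσ hG hs hβ₁ hβ₁' hβ₂ hβ₂' hα hW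
    obtain rfl : W = fun t ω => MLorc.weights qr svd hk G β₁ β₂ α W₁ (fun s i => ξ s i ω)
      (fun s => Om s ω) t := funext fun t => funext fun ω => hW t ω
    have hγ := MLorc.one_le_gam r hp
    have hmn : 4 ≤ min m n := by omega
    have hδ := MLorc.four_le_sqrt_mul hmn
    have hβδ := MLorc.mul_le_quarter_of_le hγ (by linarith) hβ₁'
    have : NeZero m := ⟨by omega⟩
    have : NeZero n := ⟨by omega⟩
    have hL := hf.nonneg
    have hT0 : (0 : ℝ) < T := by exact_mod_cast hT
    have hβ₂0 : 0 < 1 - β₂ := by linarith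
    have hfc : Continuous f := hf.differentiable.continuous
    refine ⟨MLorc.integrable_comp_weights hG hs qr svd hk W₁ hα.le
      (MLorc.continuous_l1Norm.comp hf.continuous_grad),
      MLorc.integrable_comp_weights hG hs qr svd hk W₁ hα.le hfc (T + 1), ?_⟩
    have h := MLorc.mul_avgGrad_le hf hL hσ hb hG hs qr svd hk W₁ hα.le hβ₁ hδ hβδ hβ₂ hβ₂' hT
    have hnoise := MLorc.noise_terms_ge (s := σ * √((m : ℝ) * n) / √(b : ℝ)) hγ hδ hβ₁ hβδ hβ₂
      hβ₂' (by positivity)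
    rw [div_div, ← Real.sqrt_mul (by positivity), mul_comm σ] at hnoise
    have h1 : 0 ≤ σ * √((m : ℝ) * n) / (√(b : ℝ) * T * (1 - β₂)) := by positivity
    have h2 : 0 ≤ 2 * L * α * β₁ * ((m : ℝ) * n) / (1 - β₂) := by positivity
    refine le_of_mul_le_mul_left (h.trans ?_) hα
    rw [mul_left_comm α 10]
    refine mul_le_mul_of_nonneg_left ?_ (by norm_num)
    set E := f W₁ - ∫ ω, f (MLorc.weights qr svd hk G β₁ β₂ α W₁ (fun s i => ξ s i ω)
      (fun s => Om s ω) (T + 1)) ∂P with hE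
    have h3 : E / T = α * (E / (α * T)) := by field_simp
    have h4 := mul_le_mul_of_nonneg_left hnoise hα.le
    have h5 := mul_nonneg hα.le h1
    have h6 := mul_nonneg hα.le h2
    rw [h3]
    rw [mul_comm σ (√((m : ℝ) * n))] at *
    linarith
  · intro m n r p k b T hr hp hrp _ hk hb hT Ω Ξ _ _ P _ D _ f G L σ β₁ β₂ Δ W₁ qr svd ξ Om W
      hf hL hσ hG hs hbdd hΔ _ hβ₁ hβ₁' hβ₂ hβ₂' hW
    obtain rfl : W = fun t ω => MLorc.weights qr svd hk G β₁ β₂ (√(Δ / (L * ((m : ℝ) * n) * T))) W₁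
      (fun s i => ξ s i ω) (fun s => Om s ω) t := funext fun t => funext fun ω => hW t ω
    have hγ := MLorc.one_le_gam r hp
    have hmn : 4 ≤ min m n := by omega
    have hδ := MLorc.four_le_sqrt_mul hmn
    have hβδ := MLorc.mul_le_quarter_of_le hγ (by linarith) hβ₁'
    have h := MLorc.avgGrad_le_of_bddBelow hf hL hσ hb hG hs qr svd hk W₁ hβ₁ hδ hβδ hβ₂
      (hβ₂'.trans_lt hβ) hT hbdd hΔ
    have hdL : (m : ℝ) * n * L * Δ = Δ * L * ((m : ℝ) * n) := by ring
    refine ⟨MLorc.integrable_comp_weights hG hs qr svd hk W₁ (Real.sqrt_nonneg _)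
      (MLorc.continuous_l1Norm.comp hf.continuous_grad),
      h.trans (mul_le_mul_of_nonneg_right (by norm_num) (by positivity)), ?_, ?_⟩
    · intro ε hε hεΔ hσ0 hTε
      obtain ⟨h1, h2⟩ := MLorc.ceil_complexity hε hεΔ hTε
      refine ⟨h.trans ?_, h2⟩
      rw [hdL, hσ0, zero_mul, zero_div]
      linarith
    · intro ε hε hεΔ hεσ hTε hbε
      obtain ⟨h1, h2⟩ := MLorc.ceil_complexity hε hεΔ hTε
      obtain ⟨h3, h4⟩ := MLorc.ceil_complexity hε hεσ hbε
      rw [Real.sqrt_mul (by positivity), Real.sqrt_sq hσ, mul_comm] at h3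
      constructor
      · refine h.trans ?_
        rw [hdL]
        linarith
      · refine (mul_le_mul h4 h2 (by positivity) (by positivity)).trans_eq ?_
        field_simp
        ring
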